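/- A \emph{parity game} is a tuple $\mathcal{G}=(V,\to,\Omega,\mathcal{P})$ where $V$ is a finite set of vertices, ${\to}\subseteq V\times V$ is total (every vertex has a successor), $\Omega:V\to\mathbb{N}$ assigns priorities and $\mathcal{P}:V\to\{\text{even},\text{odd}\}$ assigns owners. A \emph{play} is an infinite path; it is won by the player with the parity of the lowest priority occurring infinitely often on it. A \emph{strategy} for player $i$ is a partial function from finite paths to vertices, defined only on paths ending in a vertex owned by $i$, that yields a successor of the last vertex; it is \emph{memoryless} if its value depends only on the last vertex. A strategy $\sigma$ allows a play $p$ if $p$ follows $\sigma$ wherever $\sigma$ is defined; $\Pi^\omega_\sigma(v)$ is the set of plays from $v$ allowed by $\sigma$. Vertex $v$ is won by $i$ if $i$ has a strategy $\sigma$ such that $i$ wins every play in $\Pi^\omega_\sigma(v)$. Vertices are \emph{winner equivalent}, $v\sim_w w$, if they are won by the same player. For $U,T\subseteq V$ write $v\mapsto_{i,U}T$ if $i$ has a memoryless strategy such that every allowed play from $v$ visits $T$ and stays in $U$ before its first visit to $T$; write $v\mapsto_{i,U}$ if $i$ has a memoryless strategy such that every allowed play from $v$ stays in $U$ forever. An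 equivalence relation $R$ on $V$ is a \emph{governed stuttering bisimulation} if $v\mathrel{R}w$ implies: (a) $\Omega(v)=\Omega(w)$; (b) for each class $\mathcal{C}\neq[v]_R$ containing a successor of $v$, $w\mapsto_{\mathcal{P}(v),[w]_R}\mathcal{C}$; (c) for each player $i$, $v\mapsto_{i,[v]_R}$ implies $w\mapsto_{i,[w]_R}$. Write $v\approx w$ (\emph{governed stuttering bisimilar}) if some governed stuttering bisimulation relates $v$ and $w$. For vertices of two different games, $\approx$ is taken in their disjoint union. The \emph{quotient} of $\mathcal{G}$ has as vertices the classes of $\approx$, with $\Omega'(\mathcal{C})=\min\{\Omega(v)\mid v\in\mathcal{C}\}$; $\mathcal{C}\to'\mathcal{C}$ iff there is a player $i$ with $v\mapsto_{i,\mathcal{C}}$ for all $v\in\mathcal{C}$; for $\mathcal{C}'\ne\mathcal{C}$, $\mathcal{C}\to'\mathcal{C}'$ iff there is a player $i$ with $v\mapsto_{i,\mathcal{C}}\mathcal{C}'$ for all $v\in\mathcal{C}$; and $\mathcal{P}'(\mathcal{C})=\text{even}$ if $v\mapsto_{\text{even},\mathcal{C}}$ for all $v\in\mathcal{C}$, or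 if from some $v\in\mathcal{C}$ player even can force the very next vertex to lie in some class $\mathcal{C}'\neq\mathcal{C}$ (that is, $v$ is owned by even and has a successor in $\mathcal{C}'$, or $v$ is owned by odd and all its successors are in $\mathcal{C}'$); otherwise $\mathcal{P}'(\mathcal{C})=\text{odd}$. Equivalence is lifted to non-empty finite paths up to stuttering: one-vertex paths are equivalent if their vertices are; if $p$ and $q$ are equivalent, then so are $p\,v$ and $q$ if $v\approx\mathrm{last}(q)$, $p$ and $q\,w$ if $\mathrm{last}(p)\approx w$, and $p\,v$ and $q\,w$ if $v\approx w$. Infinite paths $p,q$ are equivalent, $p\approx q$, if each finite prefix of either one is equivalent to some finite prefix of the other. \textbf{Theorem.} Let $\mathcal{G}$ be a parity game. \begin{enumerate} \item The relation $\approx$ on $V$ is an equivalence relation, and the quotient of $\mathcal{G}$ is a parity game. \item Let $\mathcal{C}$ be a class of $\approx$ and $v\in\mathcal{C}$. For every player $i$ and every strategy $\sigma$ of $i$ in $\mathcal{G}$ there is a strategy $\psi$ of $i$ in the quotient such that for every $q\in\Pi^\omega_\psi(\mathcal{C})$ there is a $p\in\Pi^\omega_\sigma(v)$ with $p\approx q$.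 \item For all $v,w\in V$, $v\approx w$ implies $v\sim_w w$. \end{enumerate} Moreover, the refinement in (3) is strict: there is a parity game with vertices $v,w$ such that $v\sim_w w$ but not $v\approx w$. -/

import Mathlib

universe u v

namespace ParityGames

/-- The two players. -/
inductive Player : Type
  | even
  | odd

/-- The data of a parity game on the vertex set `V`: an edge relation, a priority function and an
ownership function. The two requirements on these data are in `GameGraph.IsParityGame`. -/
structure GameGraph (V : Type u) where
  /-- the edge relation -/
  edge : V → V → Prop
  /-- the priority function -/
  prio : V → ℕ
  /-- the player who owns a vertex -/
  owner : V → Player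

/-- The finite initial segment `p 0, …, p n` (with `n + 1` vertices) of an infinite sequence. -/
def initSeg {V : Type u} (p : ℕ → V) (n : ℕ) : List V :=
  (List.range (n + 1)).map p

/-- The class `{w | R v w}` of `v` under a relation `R`. -/
def eqClass {V : Type u} (R : V → V → Prop) (v : V) : Set V :=
  {w | R v w}

/-- The set of all classes of a relation. -/
def classes {V : Type u} (R : V → V → Prop) : Set (Set V) :=
  {C | ∃ v, C = eqClass R v}

namespace GameGraph

variable {V : Type u}

/-- A parity game: the vertex set is finite and the edge relation is total. -/
def IsParityGame (G : GameGraph V) : Prop :=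
  Finite V ∧ ∀ v, ∃ w, G.edge v w

/-- A finite path, as the list of its vertices. -/
def IsPath (G : GameGraph V) (p : List V) : Prop :=
  p.IsChain G.edge

/-- A play from `v`: an infinite path that starts in `v`. -/
def IsPlayFrom (G : GameGraph V) (v : V) (p : ℕ → V) : Prop :=
  p 0 = v ∧ ∀ n, G.edge (p n) (p (n + 1))

/-- `i` is the winner of the play `p`: the least priority that occurs infinitely often on `p`
has the parity of `i`. -/
def WinsPlay (G : GameGraph V) (i : Player) (p : ℕ → V) : Prop :=
  ∃ n, IsLeast {m | ∃ᶠ k in Filter.atTop, G.prio (p k) = m} n ∧ (Even n ↔ i = Player.even)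

/-- A (history-dependent) strategy for player `i`: a partial function on finite paths, defined
only for paths that end in a vertex owned by `i`, that picks a successor of the last vertex. -/
structure Strategy (G : GameGraph V) (i : Player) where
  /-- the chosen next vertex, if any -/
  move : List V → Option V
  legal : ∀ p u, move p = some u →
    G.IsPath p ∧ ∃ v, p.getLast? = some v ∧ G.owner v = i ∧ G.edge v u

namespace Strategy

variable {G : GameGraph V} {i : Player}

/-- A memoryless strategy gives the same result on paths with the same last vertex. -/
def Memoryless (σ : G.Strategy i) : Prop :=
  ∀ p q : List V, G.IsPath p → G.IsPath q → p.getLast? = q.getLast? → σ.move p = σ.move q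

/-- `σ` allows the infinite path `p`. -/
def Allows (σ : G.Strategy i) (p : ℕ → V) : Prop :=
  ∀ n u, σ.move (initSeg p n) = some u → p (n + 1) = u

/-- The set of plays from `v` that are allowed by `σ`. -/
def plays (σ : G.Strategy i) (v : V) : Set (ℕ → V) :=
  {p | G.IsPlayFrom v p ∧ σ.Allows p}

/-- `σ` is a winning strategy from `v`. -/
def Winning (σ : G.Strategy i) (v : V) : Prop :=
  ∀ p ∈ σ.plays v, G.WinsPlay i p

end Strategy

/-- Vertex `v` is won by player `i`. -/
def WonBy (G : GameGraph V) (i : Player) (v : V) : Prop :=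
  ∃ σ : G.Strategy i, σ.Winning v

/-- Winner equivalence: `v` and `w` are won by the same player. -/
def WinnerEquivalent (G : GameGraph V) (v w : V) : Prop :=
  ∃ i, G.WonBy i v ∧ G.WonBy i w

/-- Player `i` can force the play from `v` to `T` via `U`. -/
def Forces (G : GameGraph V) (i : Player) (v : V) (U T : Set V) : Prop :=
  ∃ σ : G.Strategy i, σ.Memoryless ∧
    ∀ p ∈ σ.plays v, ∃ n, p n ∈ T ∧ ∀ j < n, p j ∈ U

/-- Player `i` can force the play to diverge in `U` from `v`. -/
def Diverges (G : GameGraph V) (i : Player) (v : V) (U : Set V) : Prop :=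
  ∃ σ : G.Strategy i, σ.Memoryless ∧ ∀ p ∈ σ.plays v, ∀ j, p j ∈ U

/-- Player `i` can force the play from `v` to `T` in a single step: every edge from `v` that is
allowed by some memoryless strategy of `i` leads to `T`. -/
def ForcesStep (G : GameGraph V) (i : Player) (v : V) (T : Set V) : Prop :=
  ∃ σ : G.Strategy i, σ.Memoryless ∧
    ∀ u, G.edge v u → (∀ u', σ.move [v] = some u' → u = u') → u ∈ T

/-- Governed stuttering bisimulations. -/
structure IsGSBisimulation (G : GameGraph V) (R : V → V → Prop) : Prop where
  equivalence : Equivalence R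
  prio_eq : ∀ v w, R v w → G.prio v = G.prio w
  transfer : ∀ v w, R v w → ∀ C ∈ classes R, C ≠ eqClass R v →
    (∃ u ∈ C, G.edge v u) → G.Forces (G.owner v) w (eqClass R w) C
  diverge : ∀ v w, R v w → ∀ i, G.Diverges i v (eqClass R v) → G.Diverges i w (eqClass R w)

/-- Governed stuttering bisimilarity. -/
def GSBisimilar (G : GameGraph V) (v w : V) : Prop :=
  ∃ R, G.IsGSBisimulation R ∧ R v w

/-- The classes of governed stuttering bisimilarity, as a type. -/
def GSClass (G : GameGraph V) : Type u :=
  {C : Set V // C ∈ classes G.GSBisimilar}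

open Classical in
/-- The governed stuttering bisimulation quotient. -/
noncomputable def gsQuotient (G : GameGraph V) : GameGraph G.GSClass where
  edge C C' :=
    (C = C' ∧ ∃ i, ∀ v ∈ C.1, G.Diverges i v (eqClass G.GSBisimilar v)) ∨
    (C ≠ C' ∧ ∃ i, ∀ v ∈ C.1, G.Forces i v (eqClass G.GSBisimilar v) C'.1)
  prio C := sInf (G.prio '' C.1)
  owner C :=
    if (∀ v ∈ C.1, G.Diverges Player.even v (eqClass G.GSBisimilar v)) ∨
        (∃ v ∈ C.1, ∃ C' : G.GSClass, C' ≠ C ∧ G.ForcesStep Player.even v C'.1)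
    then Player.even else Player.odd

/-- The disjoint union of two games. -/
def disjUnion {W : Type v} (G : GameGraph V) (H : GameGraph W) : GameGraph (V ⊕ W) where
  edge := Sum.LiftRel G.edge H.edge
  prio := Sum.elim G.prio H.prio
  owner := Sum.elim G.owner H.owner

/-- Governed stuttering bisimilarity between a vertex of one game and a vertex of another game:
bisimilarity in the disjoint union. -/
def GSBisimilarBetween {W : Type v} (G : GameGraph V) (H : GameGraph W) (x : V) (y : W) : Prop :=
  (G.disjUnion H).GSBisimilar (Sum.inl x) (Sum.inr y)

end GameGraph

/-- The lifting of a relation `r` between vertices to (non-empty) finite paths, up to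
stuttering. -/
inductive PathEquiv {V : Type u} {W : Type v} (r : V → W → Prop) : List V → List W → Prop
  | single (x : V) (y : W) : r x y → PathEquiv r [x] [y]
  | left (p : List V) (q : List W) (x : V) (y : W) :
      PathEquiv r p q → q.getLast? = some y → r x y → PathEquiv r (p ++ [x]) q
  | right (p : List V) (q : List W) (x : V) (y : W) :
      PathEquiv r p q → p.getLast? = some x → r x y → PathEquiv r p (q ++ [y])
  | both (p : List V) (q : List W) (x : V) (y : W) :
      PathEquiv r p q → r x y → PathEquiv r (p ++ [x]) (q ++ [y])

/-- The lifting of a relation between vertices to infinite paths: every finite prefix of one path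
has an equivalent finite prefix of the other path, and vice versa. -/
def PlayEquiv {V : Type u} {W : Type v} (r : V → W → Prop) (p : ℕ → V) (q : ℕ → W) : Prop :=
  (∀ n, ∃ m, PathEquiv r (initSeg p n) (initSeg q m)) ∧
  (∀ m, ∃ n, PathEquiv r (initSeg p n) (initSeg q m))

end ParityGames

/-!
All notions of forcing are reduced to attractors: `Forces i v U T` says that `v` lies in the
attractor `attr i U T`, and `Diverges i v U` that `v` lies outside the attractor that the opponent
of `i` has to the complement of `U` (`forces_iff`, `diverges_iff`). Both hold because a strategy
of either player can be played against a strategy of the other (`exists_mem_plays_inter`).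

*Equivalence.* If `R` is a governed stuttering bisimulation and `U`, `T` are unions of classes of
`R`, then so is `attr i U T` (`IsGSBisimulation.attr_invariant`). Since this statement can be
iterated along chains of related vertices, the equivalence closure of bisimilarity is again a
bisimulation, and hence coincides with bisimilarity (`isGSBisimulation_gsBisimilar`).

*Quotient.* The owner of a class can force each of the moves that the quotient offers there
(`classDiverges_owner`, `classForces_owner`), because two players cannot force the play out of a
class to two different places. Consequently "belonging to the same class" is a bisimulation on the
disjoint union of the game and its quotient (`isGSBisimulation_sumCls`).

*Strategies.* Given a strategy `σ` in the game, the mimicking strategy in the quotient maintains a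
finite path allowed by `σ` that ends in the current class. If the opponent owns the class, he can
force the move he makes in the quotient also in the game, so some path allowed by `σ` follows it
(`Strategy.Follows.exists_extends_of_edge`). If the owner of `σ` owns the class, he picks a move
along which the path can be prolonged (`Strategy.Follows.exists_edge_extends`). In the limit this
yields a play allowed by `σ` that visits the classes on the play of the quotient block by block
(`Strategy.exists_blockSim`), so that both plays have the same winner.

*Winners.* By positional determinacy of finite parity games (`determined`, with Zielonka's proof),
every vertex is won by some player. That player also wins the class of the vertex in the quotient,
and no class is won by both players.
-/

/-! ### Attractors and strategies -/

namespace ParityGames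

/-- The opponent of a player. -/
def Player.opp : Player → Player
  | .even => .odd
  | .odd => .even

@[simp] theorem Player.opp_opp (i : Player) : i.opp.opp = i := by cases i <;> rfl

theorem Player.opp_ne (i : Player) : i.opp ≠ i := by cases i <;> simp [Player.opp]

theorem Player.ne_iff {i j : Player} : j ≠ i ↔ j = i.opp := by
  cases i <;> cases j <;> simp [Player.opp]

theorem Player.ne_opp_iff {i j : Player} : j ≠ i.opp ↔ j = i := by
  cases i <;> cases j <;> simp [Player.opp]

theorem initSeg_succ {V : Type u} (p : ℕ → V) (n : ℕ) :
    initSeg p (n + 1) = initSeg p n ++ [p (n + 1)] := by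
  simp [initSeg, List.range_succ]

theorem initSeg_congr {V : Type u} {p q : ℕ → V} {n : ℕ} (h : ∀ k ≤ n, p k = q k) :
    initSeg p n = initSeg q n := by
  unfold initSeg
  refine List.map_congr_left fun k hk => h k ?_
  rw [List.mem_range] at hk
  omega

theorem getLast?_initSeg {V : Type u} (p : ℕ → V) (n : ℕ) :
    (initSeg p n).getLast? = some (p n) := by
  simp [initSeg, List.range_succ]

namespace GameGraph

variable {V : Type u} {G : GameGraph V} {i : Player}

theorem isPath_initSeg {p : ℕ → V} {n : ℕ} (h : ∀ k < n, G.edge (p k) (p (k + 1))) :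
    G.IsPath (initSeg p n) := by
  induction n with
  | zero => simp [initSeg, IsPath]
  | succ n ih =>
    rw [initSeg_succ, IsPath, List.isChain_append]
    refine ⟨ih fun k hk => h k (by omega), by simp, ?_⟩
    rw [getLast?_initSeg]
    simpa using h n (by omega)

/-- The controllable predecessors of `X`: the vertices from which player `i` can make sure that
the very next vertex lies in `X`. -/
def cpre (G : GameGraph V) (i : Player) (X : Set V) : Set V :=
  {v | (G.owner v = i ∧ ∃ u ∈ X, G.edge v u) ∨ (G.owner v ≠ i ∧ ∀ u, G.edge v u → u ∈ X)}

theorem cpre_mono {X Y : Set V} (h : X ⊆ Y) : G.cpre i X ⊆ G.cpre i Y := by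
  rintro v (⟨h1, u, hu, he⟩ | ⟨h1, h2⟩)
  · exact Or.inl ⟨h1, u, h hu, he⟩
  · exact Or.inr ⟨h1, fun u he => h (h2 u he)⟩

theorem compl_cpre (X : Set V) : (G.cpre i X)ᶜ = G.cpre i.opp Xᶜ := by
  ext v
  by_cases h : G.owner v = i
  · have : G.owner v ≠ i.opp := by rw [h]; exact i.opp_ne.symm
    simp [cpre, h, i.opp_ne.symm]
    tauto
  · have := Player.ne_iff.1 h
    simp [cpre, this, i.opp_ne]
    tauto

/-- On a total game some edge witnesses that `v` is a controllable predecessor. -/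
theorem exists_edge_of_mem_cpre (ht : ∀ v, ∃ w, G.edge v w) {X : Set V} {v : V}
    (h : v ∈ G.cpre i X) : ∃ u ∈ X, G.edge v u := by
  obtain ⟨_, h⟩ | ⟨_, h⟩ := h
  · exact h
  · obtain ⟨w, hw⟩ := ht v
    exact ⟨w, h w hw, hw⟩

/-- The vertices from which player `i` can reach `T` within `n` steps, via `U`. -/
def attrStage (G : GameGraph V) (i : Player) (U T : Set V) : ℕ → Set V
  | 0 => T
  | n + 1 => G.attrStage i U T n ∪ (U ∩ G.cpre i (G.attrStage i U T n))

/-- The attractor of `T` for player `i` via `U`, as the union of its finite stages. -/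
def attr (G : GameGraph V) (i : Player) (U T : Set V) : Set V :=
  ⋃ n, G.attrStage i U T n

theorem attrStage_mono (G : GameGraph V) (i : Player) (U T : Set V) :
    Monotone (G.attrStage i U T) :=
  monotone_nat_of_le_succ fun _ => Set.subset_union_left

theorem subset_attr {U T : Set V} : T ⊆ G.attr i U T :=
  Set.subset_iUnion (G.attrStage i U T) 0

theorem mem_attr_iff {U T : Set V} {v : V} :
    v ∈ G.attr i U T ↔ ∃ n, v ∈ G.attrStage i U T n := Set.mem_iUnion

/-- Since `V` is finite, the finite stages suffice for the attractor to be closed under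
controllable predecessors. -/
theorem mem_attr_of_cpre [Finite V] {U T : Set V} {v : V} (hU : v ∈ U)
    (h : v ∈ G.cpre i (G.attr i U T)) : v ∈ G.attr i U T := by
  obtain ⟨h1, u, hu, he⟩ | ⟨h1, h2⟩ := h
  · obtain ⟨n, hn⟩ := mem_attr_iff.1 hu
    exact mem_attr_iff.2 ⟨n + 1, Or.inr ⟨hU, Or.inl ⟨h1, u, hn, he⟩⟩⟩
  · have key : ∀ u : V, ∃ n, G.edge v u → u ∈ G.attrStage i U T n := fun u => by
      by_cases he : G.edge v u
      · obtain ⟨n, hn⟩ := mem_attr_iff.1 (h2 u he)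
        exact ⟨n, fun _ => hn⟩
      · exact ⟨0, fun h => absurd h he⟩
    choose N hN using key
    obtain ⟨M, hM⟩ := (Set.finite_range N).bddAbove
    refine mem_attr_iff.2 ⟨M + 1, Or.inr ⟨hU, Or.inr ⟨h1, fun u he => ?_⟩⟩⟩
    exact G.attrStage_mono i U T (hM (Set.mem_range_self u)) (hN u he)

theorem attr_induction {U T : Set V} {P : V → Prop} (base : ∀ v ∈ T, P v)
    (step : ∀ v ∈ U, v ∈ G.cpre i {u | u ∈ G.attr i U T ∧ P u} → P v)
    {v : V} (h : v ∈ G.attr i U T) : P v := by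
  obtain ⟨n, hn⟩ := mem_attr_iff.1 h
  clear h
  induction n generalizing v with
  | zero => exact base v hn
  | succ n ih =>
    obtain h | ⟨hU, h⟩ := hn
    · exact ih h
    · exact step v hU (cpre_mono (X := G.attrStage i U T n)
        (Y := {u | u ∈ G.attr i U T ∧ P u})
        (fun u hu => ⟨mem_attr_iff.2 (Exists.intro n hu), ih hu⟩) h)

theorem attr_cases {U T : Set V} {v : V} (h : v ∈ G.attr i U T) :
    v ∈ T ∨ (v ∈ U ∧ v ∈ G.cpre i (G.attr i U T)) :=
  attr_induction (P := fun v => v ∈ T ∨ (v ∈ U ∧ v ∈ G.cpre i (G.attr i U T)))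
    (fun _ => Or.inl) (fun _ hU h => Or.inr ⟨hU, cpre_mono (fun _ hu => hu.1) h⟩) h

theorem attr_subset_attr [Finite V] {U U' T T' : Set V} (hU : U ⊆ U')
    (hT : T ⊆ G.attr i U' T') : G.attr i U T ⊆ G.attr i U' T' := fun _ =>
  attr_induction (P := (· ∈ G.attr i U' T')) hT
    (fun _ hv h => mem_attr_of_cpre (hU hv) (cpre_mono (fun _ hu => hu.2) h))

theorem attr_mono [Finite V] {U T T' : Set V} (hT : T ⊆ T') : G.attr i U T ⊆ G.attr i U T' :=
  attr_subset_attr subset_rfl (hT.trans subset_attr)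

/-- Outside the attractor of player `i`, the opponent can avoid the attractor. -/
theorem mem_cpre_opp_of_notMem_attr [Finite V] {U T : Set V} {v : V} (hU : v ∈ U)
    (h : v ∉ G.attr i U T) : v ∈ G.cpre i.opp (G.attr i U T)ᶜ := by
  rw [← compl_cpre]
  exact fun hc => h (mem_attr_of_cpre hU hc)

/-- Both players cannot force the play out of `U` to two disjoint targets. -/
theorem disjoint_attr_attr {U T T' : Set V} (h1 : Disjoint U T) (h2 : Disjoint U T')
    (h3 : Disjoint T T') {v : V} (h : v ∈ G.attr i U T) : v ∉ G.attr i.opp U T' := by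
  refine attr_induction (P := fun v => v ∉ G.attr i.opp U T') (fun v hT h' => ?_)
    (fun v hU hc h' => ?_) h
  · obtain h' | ⟨h', _⟩ := attr_cases h'
    · exact h3.le_bot ⟨hT, h'⟩
    · exact h1.le_bot ⟨h', hT⟩
  · obtain h' | ⟨_, h'⟩ := attr_cases h'
    · exact h2.le_bot ⟨hU, h'⟩
    · have hc' : v ∈ G.cpre i (G.attr i.opp U T')ᶜ := cpre_mono (fun _ hu => hu.2) hc
      rw [← compl_compl (G.cpre i _), compl_cpre, compl_compl] at hc'
      exact hc' h'

/-- A positional choice of moves that decreases a rank along the attractor. -/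
theorem exists_attr_rank (G : GameGraph V) (i : Player) (U T : Set V) :
    ∃ (f : V → V) (r : V → ℕ), ∀ v ∈ G.attr i U T, v ∉ T → v ∈ U ∧
      (G.owner v = i → G.edge v (f v) ∧ f v ∈ G.attr i U T ∧ r (f v) < r v) ∧
      (G.owner v ≠ i → ∀ u, G.edge v u → u ∈ G.attr i U T ∧ r u < r v) := by
  classical
  let r : V → ℕ := fun v => if h : ∃ n, v ∈ G.attrStage i U T n then Nat.find h else 0
  have hr : ∀ n u, u ∈ G.attrStage i U T n → r u ≤ n := fun n u hu => by
    have h : ∃ n, u ∈ G.attrStage i U T n := ⟨n, hu⟩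
    simp only [r, dif_pos h]
    exact Nat.find_min' h hu
  have key : ∀ v, ∃ w, v ∈ G.attr i U T → v ∉ T → v ∈ U ∧
      (G.owner v = i → G.edge v w ∧ w ∈ G.attr i U T ∧ r w < r v) ∧
      (G.owner v ≠ i → ∀ u, G.edge v u → u ∈ G.attr i U T ∧ r u < r v) := by
    intro v
    by_cases hv : v ∈ G.attr i U T ∧ v ∉ T
    swap
    · exact ⟨v, fun h h' => absurd ⟨h, h'⟩ hv⟩
    obtain ⟨hv, hT⟩ := hv
    have h : ∃ n, v ∈ G.attrStage i U T n := mem_attr_iff.1 hv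
    have hrv : r v = Nat.find h := dif_pos h
    obtain ⟨n, hn⟩ : ∃ n, Nat.find h = n + 1 := by
      refine Nat.exists_eq_succ_of_ne_zero fun h0 => hT ?_
      have := Nat.find_spec h
      rwa [h0] at this
    have h1 : v ∈ G.attrStage i U T (n + 1) := hn ▸ Nat.find_spec h
    obtain h1 | ⟨hU, h1⟩ := h1
    · exact absurd h1 (Nat.find_min h (by omega))
    obtain ⟨ho, u, hu, he⟩ | ⟨ho, hall⟩ := h1
    · have := hr n u hu
      exact ⟨u, fun _ _ => ⟨hU, fun _ => ⟨he, mem_attr_iff.2 ⟨n, hu⟩, by omega⟩,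
        fun h => absurd ho h⟩⟩
    · refine ⟨v, fun _ _ => ⟨hU, fun h => absurd h ho, fun _ u he => ?_⟩⟩
      have := hr n u (hall u he)
      exact ⟨mem_attr_iff.2 ⟨n, hall u he⟩, by omega⟩
  choose f hf using key
  exact ⟨f, r, hf⟩

/-- An infinite path that follows a rank-decreasing choice reaches the target. -/
theorem exists_reach_of_rank {U T : Set V} {f : V → V} {r : V → ℕ}
    (hf : ∀ v ∈ G.attr i U T, v ∉ T → v ∈ U ∧
      (G.owner v = i → G.edge v (f v) ∧ f v ∈ G.attr i U T ∧ r (f v) < r v) ∧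
      (G.owner v ≠ i → ∀ u, G.edge v u → u ∈ G.attr i U T ∧ r u < r v))
    {p : ℕ → V} (he : ∀ k, G.edge (p k) (p (k + 1)))
    (hp : ∀ k, p k ∈ G.attr i U T → p k ∉ T → G.owner (p k) = i → p (k + 1) = f (p k))
    {k : ℕ} (hk : p k ∈ G.attr i U T) :
    ∃ n ≥ k, p n ∈ T ∧ ∀ j, k ≤ j → j < n → p j ∈ U := by
  induction hm : r (p k) using Nat.strong_induction_on generalizing k with
  | _ m ih =>
  by_cases hT : p k ∈ T
  · exact ⟨k, le_rfl, hT, fun j h1 h2 => by omega⟩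
  obtain ⟨hU, h1, h2⟩ := hf _ hk hT
  have hs : p (k + 1) ∈ G.attr i U T ∧ r (p (k + 1)) < r (p k) := by
    by_cases ho : G.owner (p k) = i
    · rw [hp k hk hT ho]
      exact (h1 ho).2
    · exact h2 ho _ (he k)
  obtain ⟨n, hn, hnT, hj⟩ := ih _ (hm ▸ hs.2) hs.1 rfl
  refine ⟨n, by omega, hnT, fun j h1 h2 => ?_⟩
  obtain rfl | h := eq_or_lt_of_le h1
  · exact hU
  · exact hj j h h2

open Classical in
/-- The memoryless strategy that moves from `v ∈ S` to `f v`, and is undefined outside `S`. -/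
noncomputable def posStrategy (G : GameGraph V) (i : Player) (f : V → V) (S : Set V)
    (h : ∀ v ∈ S, G.owner v = i → G.edge v (f v)) : G.Strategy i where
  move p := if G.IsPath p ∧ ∃ v, p.getLast? = some v ∧ G.owner v = i ∧ v ∈ S
    then p.getLast?.map f else none
  legal p u hu := by
    split_ifs at hu with hc
    obtain ⟨hp, v, hv, ho, hS⟩ := hc
    rw [hv] at hu
    simp only [Option.map_some, Option.some.injEq] at hu
    exact ⟨hp, v, hv, ho, hu ▸ h v hS ho⟩

theorem posStrategy_memoryless {f : V → V} {S : Set V}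
    {h : ∀ v ∈ S, G.owner v = i → G.edge v (f v)} : (G.posStrategy i f S h).Memoryless := by
  intro p q hp hq hpq
  unfold posStrategy
  dsimp only
  rw [hpq]
  by_cases hc : ∃ v, q.getLast? = some v ∧ G.owner v = i ∧ v ∈ S
  · rw [if_pos ⟨hp, hc⟩, if_pos ⟨hq, hc⟩]
  · rw [if_neg fun h => hc h.2, if_neg fun h => hc h.2]

theorem posStrategy_follows {f : V → V} {S : Set V}
    {h : ∀ v ∈ S, G.owner v = i → G.edge v (f v)} {v : V} {p : ℕ → V}
    (hp : p ∈ (G.posStrategy i f S h).plays v) {k : ℕ} (hS : p k ∈ S)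
    (ho : G.owner (p k) = i) : p (k + 1) = f (p k) := by
  refine hp.2 k _ ?_
  have : G.IsPath (initSeg p k) := isPath_initSeg fun k _ => hp.1.2 k
  simp [posStrategy, this, getLast?_initSeg, ho, hS]

theorem Strategy.move_eq_none {σ : G.Strategy i} {p : ℕ → V} {n : ℕ} (h : G.owner (p n) ≠ i) :
    σ.move (initSeg p n) = none := by
  rw [Option.eq_none_iff_forall_not_mem]
  intro u hu
  obtain ⟨_, v, hv, ho, _⟩ := σ.legal _ u hu
  rw [getLast?_initSeg, Option.some.injEq] at hv
  exact h (hv ▸ ho)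

theorem Strategy.edge_of_move {σ : G.Strategy i} {p : ℕ → V} {n : ℕ} {u : V}
    (h : σ.move (initSeg p n) = some u) : G.edge (p n) u := by
  obtain ⟨_, v, hv, _, he⟩ := σ.legal _ u h
  rw [getLast?_initSeg, Option.some.injEq] at hv
  exact hv ▸ he

open Classical in
/-- Playing strategies of both players against each other yields a play. -/
theorem exists_mem_plays_inter (ht : ∀ v, ∃ w, G.edge v w) (σ : G.Strategy i)
    (τ : G.Strategy i.opp) (v : V) : ∃ p, p ∈ σ.plays v ∧ p ∈ τ.plays v := by
  choose g hg using ht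
  -- At most one of the two strategies is defined, namely that of the owner of the last vertex.
  let nxt : List V → V := fun l =>
    (σ.move l).getD ((τ.move l).getD (g (l.getLast?.getD v)))
  let L : ℕ → List V := fun n => Nat.rec [v] (fun _ l => l ++ [nxt l]) n
  have hL : ∀ n, L (n + 1) = L n ++ [nxt (L n)] := fun _ => rfl
  let p : ℕ → V := fun n => (L n).getLast?.getD v
  have hinit : ∀ n, initSeg p n = L n := by
    intro n
    induction n with
    | zero => rfl
    | succ n ih => rw [initSeg_succ, ih, hL]; simp [p, hL]
  have hp : ∀ n, p (n + 1) = nxt (initSeg p n) := fun n => by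
    rw [hinit]; simp [p, hL]
  have hσ : ∀ n u, σ.move (initSeg p n) = some u → p (n + 1) = u := fun n u hu => by
    rw [hp]; simp [nxt, hu]
  have hτ : ∀ n u, τ.move (initSeg p n) = some u → p (n + 1) = u := fun n u hu => by
    obtain ⟨_, w, hw, ho, _⟩ := τ.legal _ u hu
    rw [getLast?_initSeg, Option.some.injEq] at hw
    have hne : G.owner (p n) ≠ i := by rw [hw, ho]; exact i.opp_ne
    rw [hp]
    simp [nxt, hu, Strategy.move_eq_none hne]
  have he : ∀ n, G.edge (p n) (p (n + 1)) := by
    intro n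
    cases hs : σ.move (initSeg p n) with
    | some u => rw [hσ n u hs]; exact Strategy.edge_of_move hs
    | none =>
      cases hs' : τ.move (initSeg p n) with
      | some u => rw [hτ n u hs']; exact Strategy.edge_of_move hs'
      | none =>
        rw [hp]
        simp only [nxt, hs, hs', Option.getD_none, getLast?_initSeg, Option.getD_some]
        exact hg _
  exact ⟨p, ⟨⟨rfl, he⟩, hσ⟩, ⟨⟨rfl, he⟩, hτ⟩⟩

theorem forces_iff (hG : G.IsParityGame) {v : V} {U T : Set V} :
    G.Forces i v U T ↔ v ∈ G.attr i U T := by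
  classical
  have := hG.1
  constructor
  · rintro ⟨σ, _, hσ⟩
    by_contra hv
    -- The opponent stays outside the attractor for as long as the play has not left `U`.
    have key : ∀ x, ∃ w, G.edge x w ∧
        (x ∈ U → x ∉ G.attr i U T → G.owner x = i.opp → w ∉ G.attr i U T) := by
      intro x
      by_cases hx : x ∈ U ∧ x ∉ G.attr i U T ∧ G.owner x = i.opp
      · obtain ⟨_, w, hw, he⟩ | ⟨ho, _⟩ := mem_cpre_opp_of_notMem_attr hx.1 hx.2.1
        · exact ⟨w, he, fun _ _ _ => hw⟩
        · exact absurd hx.2.2 ho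
      · obtain ⟨w, hw⟩ := hG.2 x
        exact ⟨w, hw, fun h1 h2 h3 => absurd ⟨h1, h2, h3⟩ hx⟩
    choose g hg hg' using key
    obtain ⟨p, hpσ, hpτ⟩ := exists_mem_plays_inter hG.2 σ
      (G.posStrategy i.opp g Set.univ fun x _ _ => hg x) v
    obtain ⟨n, hnT, hnU⟩ := hσ p hpσ
    have hout : ∀ k ≤ n, p k ∉ G.attr i U T := by
      intro k
      induction k with
      | zero => intro _; rw [hpσ.1.1]; exact hv
      | succ k ih =>
        intro hk
        have h1 := ih (by omega)
        have hU := hnU k (by omega)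
        by_cases ho : G.owner (p k) = i.opp
        · rw [posStrategy_follows hpτ (Set.mem_univ _) ho]
          exact hg' _ hU h1 ho
        · obtain ⟨ho', _⟩ | ⟨_, hall⟩ := mem_cpre_opp_of_notMem_attr hU h1
          · exact absurd ho' ho
          · exact hall _ (hpσ.1.2 k)
    exact hout n le_rfl (subset_attr hnT)
  · intro hv
    obtain ⟨f, r, hf⟩ := G.exists_attr_rank i U T
    refine ⟨G.posStrategy i f (G.attr i U T \ T) fun x hx ho => ((hf x hx.1 hx.2).2.1 ho).1,
      posStrategy_memoryless, fun p hp => ?_⟩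
    obtain ⟨n, _, h1, h2⟩ := exists_reach_of_rank hf hp.1.2
      (fun k h1 h2 ho => posStrategy_follows hp ⟨h1, h2⟩ ho) (k := 0) (by rwa [hp.1.1])
    exact ⟨n, h1, fun j hj => h2 j (Nat.zero_le _) hj⟩

theorem diverges_iff (hG : G.IsParityGame) {v : V} {U : Set V} :
    G.Diverges i v U ↔ v ∉ G.attr i.opp U Uᶜ := by
  have := hG.1
  constructor
  · rintro ⟨σ, _, hσ⟩ hv
    obtain ⟨τ, _, hτ⟩ := (forces_iff hG).2 hv
    obtain ⟨p, h1, h2⟩ := exists_mem_plays_inter hG.2 σ τ v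
    obtain ⟨n, hn, _⟩ := hτ p h2
    exact hn (hσ p h1 n)
  · intro hv
    have hN : ∀ x ∉ G.attr i.opp U Uᶜ, x ∈ U ∧ x ∈ G.cpre i (G.attr i.opp U Uᶜ)ᶜ := by
      intro x hx
      have hU : x ∈ U := by
        by_contra h
        exact hx (subset_attr h)
      have := mem_cpre_opp_of_notMem_attr hU hx
      rw [Player.opp_opp] at this
      exact ⟨hU, this⟩
    have key : ∀ x, ∃ w, x ∉ G.attr i.opp U Uᶜ → G.owner x = i →
        G.edge x w ∧ w ∉ G.attr i.opp U Uᶜ := by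
      intro x
      by_cases hx : x ∉ G.attr i.opp U Uᶜ ∧ G.owner x = i
      · obtain ⟨_, w, hw, he⟩ | ⟨ho, _⟩ := (hN x hx.1).2
        · exact ⟨w, fun _ _ => ⟨he, hw⟩⟩
        · exact absurd hx.2 ho
      · exact ⟨x, fun h1 h2 => absurd ⟨h1, h2⟩ hx⟩
    choose f hf using key
    refine ⟨G.posStrategy i f (G.attr i.opp U Uᶜ)ᶜ fun x hx ho => (hf x hx ho).1,
      posStrategy_memoryless, fun p hp j => (hN _ ?_).1⟩
    induction j with
    | zero => rwa [hp.1.1]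
    | succ j ih =>
      by_cases ho : G.owner (p j) = i
      · rw [posStrategy_follows hp ih ho]
        exact (hf _ ih ho).2
      · obtain ⟨ho', _⟩ | ⟨_, hall⟩ := (hN _ ih).2
        · exact absurd ho' ho
        · exact hall _ (hp.1.2 j)

theorem forcesStep_iff (hG : G.IsParityGame) {v : V} {T : Set V} :
    G.ForcesStep i v T ↔ v ∈ G.cpre i T := by
  constructor
  · rintro ⟨σ, _, hσ⟩
    by_cases ho : G.owner v = i
    · left
      cases hm : σ.move [v] with
      | none =>
        obtain ⟨w, hw⟩ := hG.2 v
        exact ⟨ho, w, hσ w hw (by simp [hm]), hw⟩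
      | some w =>
        have he : G.edge v w := Strategy.edge_of_move (p := fun _ => v) (n := 0) hm
        exact ⟨ho, w, hσ w he (by simp [hm]), he⟩
    · refine Or.inr ⟨ho, fun u he => hσ u he fun u' hu' => ?_⟩
      have : σ.move [v] = none := Strategy.move_eq_none (p := fun _ => v) (n := 0) ho
      simp [this] at hu'
  · rintro (⟨ho, w, hw, he⟩ | ⟨ho, hall⟩)
    · refine ⟨G.posStrategy i (fun _ => w) {v} (by rintro x rfl _; exact he),
        posStrategy_memoryless, fun u _ hu => ?_⟩
      rw [hu w (by simp [posStrategy, IsPath, ho])]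
      exact hw
    · exact ⟨G.posStrategy i id ∅ (by simp), posStrategy_memoryless, fun u he _ => hall u he⟩

end GameGraph
end ParityGames

/-! ### Bisimilarity is a bisimulation -/

namespace ParityGames
namespace GameGraph

variable {V : Type u} {G : GameGraph V} {i : Player}

theorem eqClass_eq {R : V → V → Prop} (hR : Equivalence R) {v w : V} (h : R v w) :
    eqClass R v = eqClass R w :=
  Set.ext fun _ => ⟨fun h' => hR.trans (hR.symm h) h', fun h' => hR.trans h h'⟩

/-- The transfer condition of a governed stuttering bisimulation, in terms of attractors. -/
theorem IsGSBisimulation.mem_attr (hG : G.IsParityGame) {R : V → V → Prop}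
    (hR : G.IsGSBisimulation R) {v w u : V} (h : R v w) (he : G.edge v u) (hu : ¬ R v u) :
    w ∈ G.attr (G.owner v) (eqClass R w) (eqClass R u) := by
  refine (forces_iff hG).1 (hR.transfer v w h _ ⟨u, rfl⟩ (fun hc => hu ?_)
    ⟨u, hR.equivalence.refl u, he⟩)
  have : u ∈ eqClass R u := hR.equivalence.refl u
  rwa [hc] at this

/-- Attractors between sets that are unions of classes of a governed stuttering bisimulation are
unions of classes. The delicate case is a vertex `v` of the opponent all of whose successors are
outside its class: if some `w` related to `v` were not in the attractor, then the opponent could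
keep the play in the class of `w`, which he cannot do from `v`. -/
theorem IsGSBisimulation.attr_invariant (hG : G.IsParityGame) {R : V → V → Prop}
    (hR : G.IsGSBisimulation R) {U T : Set V} (hU : ∀ v w, R v w → v ∈ U → w ∈ U)
    (hT : ∀ v w, R v w → v ∈ T → w ∈ T) {v w : V} (hvw : R v w) (hv : v ∈ G.attr i U T) :
    w ∈ G.attr i U T := by
  have := hG.1
  have eqv := hR.equivalence
  refine attr_induction (P := fun v => ∀ w, R v w → w ∈ G.attr i U T)
    (fun v hv w hvw => subset_attr (hT v w hvw hv)) ?_ hv w hvw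
  clear hv hvw v w
  intro v hvU hv w hvw
  obtain ⟨ho, u, ⟨-, hu⟩, he⟩ | ⟨ho, hall⟩ := hv
  · by_cases hvu : R v u
    · exact hu w (eqv.trans (eqv.symm hvu) hvw)
    · have hw := hR.mem_attr hG hvw he hvu
      rw [ho] at hw
      exact attr_subset_attr (fun z hz => hU v z (eqv.trans hvw hz) hvU) (fun z hz => hu z hz) hw
  · have hsucc := fun u he => (hall u he).2
    by_cases hin : ∃ u, G.edge v u ∧ R v u
    · obtain ⟨u, he, hvu⟩ := hin
      exact hsucc u he w (eqv.trans (eqv.symm hvu) hvw)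
    push Not at hin
    by_contra hw
    -- If `i` could force the play from `w` out of the class of `w`, then also to `T`: from `v` an
    -- exit from the class must be matched at once, so every exit leads into the attractor of `T`.
    have hY : w ∉ G.attr i (eqClass R w) (eqClass R w)ᶜ := by
      intro hY
      refine hw (attr_induction (P := fun z => R w z → z ∈ G.attr i U T)
        (fun z hz hz' => absurd hz' hz) ?_ hY (eqv.refl w))
      intro z _ hz hwz
      have hvz := eqv.trans hvw hwz
      have hout : ∀ u, G.edge z u → ¬ R w u → u ∈ G.attr i U T := by
        intro u he hwu
        have h1 := hR.mem_attr hG (eqv.symm hvz) he fun h => hwu (eqv.trans hwz h)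
        obtain h1 | ⟨-, h1⟩ := attr_cases h1
        · exact absurd (eqv.trans (eqv.symm hvw) (eqv.symm h1)) hwu
        · obtain ⟨x, hx, hvx⟩ := exists_edge_of_mem_cpre hG.2 h1
          obtain hx | ⟨hx, -⟩ := attr_cases hx
          · exact hsucc x hvx u (eqv.symm hx)
          · exact absurd hx (hin x hvx)
      have hstep : ∀ u, G.edge z u → (R w u → u ∈ G.attr i U T) → u ∈ G.attr i U T :=
        fun u he h => (em (R w u)).elim h (hout u he)
      refine mem_attr_of_cpre (hU v z hvz hvU) ?_
      obtain ⟨ho, u, hu, he⟩ | ⟨ho, hall⟩ := hz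
      · exact Or.inl ⟨ho, u, hstep u he hu.2, he⟩
      · exact Or.inr ⟨ho, fun u he => hstep u he (hall u he).2⟩
    have hd : G.Diverges i.opp w (eqClass R w) := by
      rw [diverges_iff hG, Player.opp_opp]
      exact hY
    have hd' := hR.diverge w v (eqv.symm hvw) i.opp hd
    rw [diverges_iff hG, Player.opp_opp] at hd'
    exact hd' (mem_attr_of_cpre (eqv.refl v)
      (Or.inr ⟨ho, fun u he => subset_attr (hin u he)⟩))

/-- Attractors are invariant under bisimilarity, even though it is not yet known to be a
bisimulation itself. -/
theorem GSBisimilar.mem_attr_of_invariant (hG : G.IsParityGame) {U T : Set V}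
    (hU : ∀ v w, G.GSBisimilar v w → v ∈ U → w ∈ U)
    (hT : ∀ v w, G.GSBisimilar v w → v ∈ T → w ∈ T) {v w : V} (h : G.GSBisimilar v w)
    (hv : v ∈ G.attr i U T) : w ∈ G.attr i U T := by
  obtain ⟨R, hR, hvw⟩ := h
  exact hR.attr_invariant hG (fun v w h => hU v w ⟨R, hR, h⟩) (fun v w h => hT v w ⟨R, hR, h⟩)
    hvw hv

theorem GSBisimilar.symm {v w : V} : G.GSBisimilar v w → G.GSBisimilar w v :=
  fun ⟨R, hR, h⟩ => ⟨R, hR, hR.equivalence.symm h⟩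

/-- The equivalence closure of bisimilarity is a governed stuttering bisimulation. -/
theorem isGSBisimulation_eqvGen (hG : G.IsParityGame) :
    G.IsGSBisimulation (Relation.EqvGen G.GSBisimilar) := by
  set E := Relation.EqvGen G.GSBisimilar with hE
  have eqv : Equivalence E := Relation.EqvGen.is_equivalence _
  have key : ∀ (j : Player) (U T : Set V), (∀ v w, E v w → v ∈ U → w ∈ U) →
      (∀ v w, E v w → v ∈ T → w ∈ T) → ∀ v w, E v w →
        (v ∈ G.attr j U T ↔ w ∈ G.attr j U T) := by
    intro j U T hU hT v w h
    induction h with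
    | rel x y h =>
      have hU' := fun v w h => hU v w (.rel v w h)
      have hT' := fun v w h => hT v w (.rel v w h)
      exact ⟨h.mem_attr_of_invariant hG hU' hT', h.symm.mem_attr_of_invariant hG hU' hT'⟩
    | refl => exact Iff.rfl
    | symm _ _ _ ih => exact ih.symm
    | trans _ _ _ _ _ ih1 ih2 => exact ih1.trans ih2
  have hinv : ∀ x v w, E v w → v ∈ eqClass E x → w ∈ eqClass E x :=
    fun x v w h hv => eqv.trans hv h
  have hinv' : ∀ x v w, E v w → v ∈ (eqClass E x)ᶜ → w ∈ (eqClass E x)ᶜ :=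
    fun x v w h hv hw => hv (eqv.trans hw (eqv.symm h))
  refine ⟨eqv, fun v w h => ?_, fun v w h C hC hCv hu => ?_, fun v w h j hd => ?_⟩
  · induction h with
    | rel x y h =>
      obtain ⟨R, hR, h⟩ := h
      exact hR.prio_eq _ _ h
    | refl => rfl
    | symm _ _ _ ih => exact ih.symm
    | trans _ _ _ _ _ ih1 ih2 => exact ih1.trans ih2
  · obtain ⟨c, rfl⟩ := hC
    obtain ⟨u, hu, he⟩ := hu
    have := hG.1
    rw [forces_iff hG, ← eqClass_eq eqv h,
      ← key _ _ _ (hinv v) (hinv c) v w h]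
    exact mem_attr_of_cpre (eqv.refl v) (Or.inl ⟨rfl, u, subset_attr hu, he⟩)
  · rw [diverges_iff hG] at hd ⊢
    rwa [← eqClass_eq eqv h, ← key _ _ _ (hinv v) (hinv' v) v w h]

theorem isGSBisimulation_gsBisimilar (hG : G.IsParityGame) :
    G.IsGSBisimulation G.GSBisimilar := by
  have h : Relation.EqvGen G.GSBisimilar = G.GSBisimilar := by
    funext v w
    exact propext ⟨fun h => ⟨_, isGSBisimulation_eqvGen hG, h⟩, .rel v w⟩
  exact h ▸ isGSBisimulation_eqvGen hG

end GameGraph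
end ParityGames

/-! ### The quotient -/

namespace ParityGames
namespace GameGraph

variable {V : Type u} {G : GameGraph V} {i : Player}

/-- The class of a vertex under governed stuttering bisimilarity. -/
def cls (G : GameGraph V) (v : V) : G.GSClass := ⟨eqClass G.GSBisimilar v, v, rfl⟩

theorem exists_cls_eq (C : G.GSClass) : ∃ v, G.cls v = C := by
  obtain ⟨C, v, rfl⟩ := C
  exact ⟨v, rfl⟩

theorem mem_class_iff (hG : G.IsParityGame) {v : V} {C : G.GSClass} :
    v ∈ C.1 ↔ G.cls v = C := by
  have eqv := (isGSBisimulation_gsBisimilar hG).equivalence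
  obtain ⟨w, rfl⟩ := exists_cls_eq C
  constructor
  · intro h
    exact Subtype.ext (eqClass_eq eqv (eqv.symm h))
  · intro h
    have : v ∈ (G.cls v).1 := eqv.refl v
    rwa [h] at this

theorem eqClass_of_mem (hG : G.IsParityGame) {v : V} {C : G.GSClass} (h : v ∈ C.1) :
    eqClass G.GSBisimilar v = C.1 := by
  rw [← (mem_class_iff hG).1 h]
  rfl

theorem class_nonempty (hG : G.IsParityGame) (C : G.GSClass) : ∃ v, v ∈ C.1 :=
  (exists_cls_eq C).imp fun _ => (mem_class_iff hG).2

theorem disjoint_class (hG : G.IsParityGame) {C D : G.GSClass} (h : C ≠ D) :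
    Disjoint C.1 D.1 := by
  rw [Set.disjoint_left]
  intro v hC hD
  exact h (((mem_class_iff hG).1 hC).symm.trans ((mem_class_iff hG).1 hD))

theorem class_invariant (hG : G.IsParityGame) (C : G.GSClass) (v w : V)
    (h : G.GSBisimilar v w) (hv : v ∈ C.1) : w ∈ C.1 := by
  rw [← eqClass_of_mem hG hv]
  exact h

theorem compl_class_invariant (hG : G.IsParityGame) (C : G.GSClass) (v w : V)
    (h : G.GSBisimilar v w) (hv : v ∈ C.1ᶜ) : w ∈ C.1ᶜ :=
  fun hw => hv (class_invariant hG C w v h.symm hw)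

theorem gsBisimilar_of_mem (hG : G.IsParityGame) {C : G.GSClass} {v w : V} (hv : v ∈ C.1)
    (hw : w ∈ C.1) : G.GSBisimilar v w := by
  rwa [← eqClass_of_mem hG hv] at hw

/-- From every vertex of the class `C`, player `i` can force the play to the class `D` via `C`. -/
def ClassForces (G : GameGraph V) (i : Player) (C D : G.GSClass) : Prop :=
  ∀ v ∈ C.1, v ∈ G.attr i C.1 D.1

/-- From every vertex of the class `C`, player `i` can keep the play in `C`. -/
def ClassDiverges (G : GameGraph V) (i : Player) (C : G.GSClass) : Prop :=
  ∀ v ∈ C.1, v ∉ G.attr i.opp C.1 C.1ᶜ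

theorem classForces_of_mem (hG : G.IsParityGame) {C D : G.GSClass} {v : V} (hv : v ∈ C.1)
    (h : v ∈ G.attr i C.1 D.1) : G.ClassForces i C D := fun _ hw =>
  (gsBisimilar_of_mem hG hv hw).mem_attr_of_invariant hG (class_invariant hG C)
    (class_invariant hG D) h

theorem classDiverges_of_mem (hG : G.IsParityGame) {C : G.GSClass} {v : V} (hv : v ∈ C.1)
    (h : v ∉ G.attr i.opp C.1 C.1ᶜ) : G.ClassDiverges i C := fun _ hw hc =>
  h ((gsBisimilar_of_mem hG hw hv).mem_attr_of_invariant hG (class_invariant hG C)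
    (compl_class_invariant hG C) hc)

theorem classForces_of_edge (hG : G.IsParityGame) {C D : G.GSClass} {v u : V} (hv : v ∈ C.1)
    (hu : u ∈ D.1) (he : G.edge v u) : G.ClassForces (G.owner v) C D := by
  have := hG.1
  exact classForces_of_mem hG hv (mem_attr_of_cpre hv (Or.inl ⟨rfl, u, subset_attr hu, he⟩))

theorem ClassForces.not_classDiverges (hG : G.IsParityGame) {C D : G.GSClass} (hCD : C ≠ D)
    (h : G.ClassForces i C D) : ¬ G.ClassDiverges i.opp C := by
  have := hG.1
  intro hd
  obtain ⟨v, hv⟩ := class_nonempty hG C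
  refine hd v hv ?_
  rw [Player.opp_opp]
  exact attr_mono (Set.disjoint_right.1 (disjoint_class hG hCD)) (h v hv)

theorem ClassForces.eq (hG : G.IsParityGame) {C D E : G.GSClass} (hCD : C ≠ D) (hCE : C ≠ E)
    (h : G.ClassForces i C D) (h' : G.ClassForces i.opp C E) : D = E := by
  by_contra hDE
  obtain ⟨v, hv⟩ := class_nonempty hG C
  exact disjoint_attr_attr (disjoint_class hG hCD) (disjoint_class hG hCE)
    (disjoint_class hG hDE) (h v hv) (h' v hv)

/-- A player who reaches `T` from a vertex of `U`, via `U`, can do so from some vertex of `U` in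
a single step. -/
theorem exists_mem_cpre_of_mem_attr {U T : Set V} {v : V} (hv : v ∈ U)
    (h : v ∈ G.attr i U T) : (∃ x ∈ U, x ∈ T) ∨ ∃ x ∈ U, x ∈ G.cpre i T := by
  refine attr_induction
    (P := fun v => v ∈ U → (∃ x ∈ U, x ∈ T) ∨ ∃ x ∈ U, x ∈ G.cpre i T)
    (fun v hT hU => Or.inl ⟨v, hU, hT⟩) (fun v hU hc _ => ?_) h hv
  by_contra hno
  refine hno (Or.inr ⟨v, hU, cpre_mono (fun u hu => ?_) hc⟩)
  obtain hT | ⟨hU', -⟩ := attr_cases hu.1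
  · exact hT
  · exact absurd (hu.2 hU') hno

theorem exists_exit (hG : G.IsParityGame) {C : G.GSClass} (h : ¬ G.ClassDiverges i C) :
    ∃ x ∈ C.1, ∃ D, C ≠ D ∧ ∃ u ∈ D.1, G.edge x u := by
  simp only [ClassDiverges, not_forall, not_not] at h
  obtain ⟨v, hv, h⟩ := h
  obtain ⟨x, hx, hx'⟩ | ⟨x, hx, hc⟩ := exists_mem_cpre_of_mem_attr hv h
  · exact absurd hx hx'
  · obtain ⟨u, hu, he⟩ := exists_edge_of_mem_cpre hG.2 hc
    have hu' : u ∈ (G.cls u).1 := (mem_class_iff hG).2 rfl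
    exact ⟨x, hx, G.cls u, fun hC => hu (hC ▸ hu'), u, hu', he⟩

theorem gsQuotient_edge_iff (hG : G.IsParityGame) {C D : G.GSClass} :
    G.gsQuotient.edge C D ↔
      (C = D ∧ ∃ i, G.ClassDiverges i C) ∨ (C ≠ D ∧ ∃ i, G.ClassForces i C D) := by
  have h1 : ∀ i, (∀ v ∈ C.1, G.Diverges i v (eqClass G.GSBisimilar v)) ↔ G.ClassDiverges i C :=
    fun i => forall₂_congr fun v hv => by rw [eqClass_of_mem hG hv, diverges_iff hG]
  have h2 : ∀ i, (∀ v ∈ C.1, G.Forces i v (eqClass G.GSBisimilar v) D.1) ↔ G.ClassForces i C D :=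
    fun i => forall₂_congr fun v hv => by rw [eqClass_of_mem hG hv, forces_iff hG]
  simp only [gsQuotient, h1, h2]

theorem gsQuotient_owner_eq_even_iff (hG : G.IsParityGame) {C : G.GSClass} :
    G.gsQuotient.owner C = .even ↔
      G.ClassDiverges .even C ∨ ∃ v ∈ C.1, ∃ D, D ≠ C ∧ v ∈ G.cpre .even D.1 := by
  have h1 : (∀ v ∈ C.1, G.Diverges .even v (eqClass G.GSBisimilar v)) ↔
      G.ClassDiverges .even C :=
    forall₂_congr fun v hv => by rw [eqClass_of_mem hG hv, diverges_iff hG]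
  have h2 : (∃ v ∈ C.1, ∃ D : G.GSClass, D ≠ C ∧ G.ForcesStep .even v D.1) ↔
      ∃ v ∈ C.1, ∃ D : G.GSClass, D ≠ C ∧ v ∈ G.cpre .even D.1 := by
    simp only [forcesStep_iff hG]
  rw [← h1, ← h2]
  unfold gsQuotient
  dsimp only
  split_ifs with h
  · exact iff_of_true rfl h
  · exact iff_of_false nofun h

theorem gsQuotient_edge_of_edge (hG : G.IsParityGame) {C D : G.GSClass} (hCD : C ≠ D) {v u : V}
    (hv : v ∈ C.1) (hu : u ∈ D.1) (he : G.edge v u) : G.gsQuotient.edge C D :=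
  (gsQuotient_edge_iff hG).2 (Or.inr ⟨hCD, _, classForces_of_edge hG hv hu he⟩)

theorem gsQuotient_edge_self (hG : G.IsParityGame) {C : G.GSClass} (h : G.ClassDiverges i C) :
    G.gsQuotient.edge C C :=
  (gsQuotient_edge_iff hG).2 (Or.inl ⟨rfl, _, h⟩)

theorem isParityGame_gsQuotient (hG : G.IsParityGame) : G.gsQuotient.IsParityGame := by
  have := hG.1
  refine ⟨inferInstanceAs (Finite {C : Set V // C ∈ classes G.GSBisimilar}), fun C => ?_⟩
  by_cases h : G.ClassDiverges .even C
  · exact ⟨C, gsQuotient_edge_self hG h⟩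
  · obtain ⟨x, hx, D, hD, u, hu, he⟩ := exists_exit hG h
    exact ⟨D, gsQuotient_edge_of_edge hG hD hx hu he⟩

/-- The owner of a class that has an edge to itself can keep the play in that class. -/
theorem classDiverges_owner (hG : G.IsParityGame) {C : G.GSClass}
    (h : G.gsQuotient.edge C C) : G.ClassDiverges (G.gsQuotient.owner C) C := by
  have := hG.1
  obtain ⟨-, j, hj⟩ | ⟨h, -⟩ := (gsQuotient_edge_iff hG).1 h
  swap
  · exact absurd rfl h
  by_cases he : G.ClassDiverges .even C
  · rwa [(gsQuotient_owner_eq_even_iff hG).2 (Or.inl he)]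
  have hj' : j = .odd := by
    cases j
    · exact absurd hj he
    · rfl
  subst hj'
  have ho : G.gsQuotient.owner C ≠ .even := by
    rw [Ne, gsQuotient_owner_eq_even_iff hG]
    rintro (h | ⟨v, hv, D, hD, hc⟩)
    · exact he h
    · exact (classForces_of_mem hG hv (mem_attr_of_cpre hv
        (cpre_mono subset_attr hc))).not_classDiverges hG hD.symm hj
  rw [Player.ne_iff.1 ho]
  exact hj

/-- The owner of a class can force every move to another class that the quotient offers. -/
theorem classForces_owner (hG : G.IsParityGame) {C D : G.GSClass} (hCD : C ≠ D)
    (h : G.gsQuotient.edge C D) : G.ClassForces (G.gsQuotient.owner C) C D := by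
  have := hG.1
  obtain ⟨rfl, -⟩ | ⟨-, j, hj⟩ := (gsQuotient_edge_iff hG).1 h
  · exact absurd rfl hCD
  by_cases hoj : G.gsQuotient.owner C = j
  · rwa [hoj]
  cases j with
  | even =>
    -- If even can force the move, then even can make it in one step from some vertex of `C`, so
    -- even owns the class.
    exfalso
    obtain ⟨v, hv⟩ := class_nonempty hG C
    rw [gsQuotient_owner_eq_even_iff hG] at hoj
    obtain ⟨x, hx, hx'⟩ | ⟨x, hx, hc⟩ := exists_mem_cpre_of_mem_attr hv (hj v hv)
    · exact (disjoint_class hG hCD).le_bot ⟨hx, hx'⟩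
    · exact hoj (Or.inr ⟨x, hx, D, hCD.symm, hc⟩)
  | odd =>
    have ho : G.gsQuotient.owner C = .even := Player.ne_iff.1 hoj
    rw [ho]
    obtain hd | ⟨v, hv, E, hE, hc⟩ := (gsQuotient_owner_eq_even_iff hG).1 ho
    · exact absurd hd (hj.not_classDiverges hG hCD)
    · -- Even can force a move to `E` and odd one to `D`, so these classes coincide.
      have hE' : G.ClassForces .even C E :=
        classForces_of_mem hG hv (mem_attr_of_cpre hv (cpre_mono subset_attr hc))
      rwa [hE'.eq hG hE.symm hCD hj] at hE'

/-- If player `i` can force the play from the class `C` to the class `D` in the game, then one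
step suffices for this in the quotient. -/
theorem ClassForces.mem_cpre (hG : G.IsParityGame) {C D : G.GSClass} (hCD : C ≠ D)
    (h : G.ClassForces i C D) : C ∈ G.gsQuotient.cpre i {D} := by
  have he : G.gsQuotient.edge C D := (gsQuotient_edge_iff hG).2 (Or.inr ⟨hCD, i, h⟩)
  by_cases ho : G.gsQuotient.owner C = i
  · exact Or.inl ⟨ho, D, rfl, he⟩
  · refine Or.inr ⟨ho, fun E hE => ?_⟩
    have ho' := Player.ne_iff.1 ho
    by_cases hCE : C = E
    · subst hCE
      have := classDiverges_owner hG hE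
      rw [ho'] at this
      exact absurd this (h.not_classDiverges hG hCD)
    · have := classForces_owner hG hCE hE
      rw [ho'] at this
      exact (h.eq hG hCD hCE this).symm

/-- In the quotient, player `i` can force the play out of the vertex `C` exactly if his opponent
cannot keep the play in the class `C` of the game. -/
theorem mem_attr_gsQuotient_iff (hG : G.IsParityGame) {C : G.GSClass} :
    C ∈ G.gsQuotient.attr i {C} {C}ᶜ ↔ ¬ G.ClassDiverges i.opp C := by
  have := (isParityGame_gsQuotient hG).1
  constructor
  · intro h hd
    refine attr_induction (P := fun E => E ≠ C) (fun E hE => hE) ?_ h rfl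
    rintro E rfl hc
    exfalso
    obtain ⟨ho, D, hD, he⟩ | ⟨ho, hall⟩ := hc
    · have := classForces_owner hG hD.2.symm he
      rw [ho] at this
      exact this.not_classDiverges hG hD.2.symm hd
    · exact (hall E (gsQuotient_edge_self hG hd)).2 rfl
  · intro h
    refine mem_attr_of_cpre rfl (cpre_mono subset_attr ?_)
    by_cases ho : G.gsQuotient.owner C = i
    · obtain ⟨x, hx, D, hD, u, hu, he⟩ := exists_exit hG h
      exact Or.inl ⟨ho, D, hD.symm, gsQuotient_edge_of_edge hG hD hx hu he⟩
    · refine Or.inr ⟨ho, ?_⟩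
      rintro D hD rfl
      have := classDiverges_owner hG hD
      rw [Player.ne_iff.1 ho] at this
      exact h this

theorem gsQuotient_prio (hG : G.IsParityGame) {C : G.GSClass} {v : V} (hv : v ∈ C.1) :
    G.gsQuotient.prio C = G.prio v := by
  have : G.prio '' C.1 = {G.prio v} := by
    refine Set.eq_singleton_iff_nonempty_unique_mem.2 ⟨⟨_, v, hv, rfl⟩, ?_⟩
    rintro _ ⟨w, hw, rfl⟩
    exact ((isGSBisimulation_gsBisimilar hG).prio_eq v w (gsBisimilar_of_mem hG hv hw)).symm
  simp [gsQuotient, this]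

/-! ### The quotient is bisimilar to the game -/

theorem isParityGame_disjUnion {W : Type v} {H : GameGraph W} (hG : G.IsParityGame)
    (hH : H.IsParityGame) : (G.disjUnion H).IsParityGame := by
  have := hG.1
  have := hH.1
  refine ⟨inferInstance, ?_⟩
  rintro (x | y)
  · obtain ⟨w, hw⟩ := hG.2 x
    exact ⟨.inl w, .inl hw⟩
  · obtain ⟨w, hw⟩ := hH.2 y
    exact ⟨.inr w, .inr hw⟩

theorem cpre_disjUnion_inl {W : Type v} {H : GameGraph W} (X : Set (V ⊕ W)) :
    Sum.inl ⁻¹' (G.disjUnion H).cpre i X = G.cpre i (Sum.inl ⁻¹' X) := by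
  ext x
  simp [cpre, disjUnion]

theorem cpre_disjUnion_inr {W : Type v} {H : GameGraph W} (X : Set (V ⊕ W)) :
    Sum.inr ⁻¹' (G.disjUnion H).cpre i X = H.cpre i (Sum.inr ⁻¹' X) := by
  ext x
  simp [cpre, disjUnion]

theorem attr_disjUnion_inl {W : Type v} {H : GameGraph W} (U T : Set (V ⊕ W)) :
    Sum.inl ⁻¹' (G.disjUnion H).attr i U T = G.attr i (Sum.inl ⁻¹' U) (Sum.inl ⁻¹' T) := by
  rw [attr, attr, Set.preimage_iUnion]
  congr 1
  funext n
  induction n with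
  | zero => rfl
  | succ n ih =>
    simp only [attrStage, Set.preimage_union, Set.preimage_inter, cpre_disjUnion_inl, ih]

theorem attr_disjUnion_inr {W : Type v} {H : GameGraph W} (U T : Set (V ⊕ W)) :
    Sum.inr ⁻¹' (G.disjUnion H).attr i U T = H.attr i (Sum.inr ⁻¹' U) (Sum.inr ⁻¹' T) := by
  rw [attr, attr, Set.preimage_iUnion]
  congr 1
  funext n
  induction n with
  | zero => rfl
  | succ n ih =>
    simp only [attrStage, Set.preimage_union, Set.preimage_inter, cpre_disjUnion_inr, ih]

/-- The class to which a vertex of the game or of its quotient belongs. -/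
def sumCls (G : GameGraph V) : V ⊕ G.GSClass → G.GSClass := Sum.elim G.cls id

theorem eqClass_sumCls (x : V ⊕ G.GSClass) :
    eqClass (fun x y => G.sumCls x = G.sumCls y) x = G.sumCls ⁻¹' {G.sumCls x} := by
  ext y
  exact eq_comm

theorem isGSBisimulation_sumCls (hG : G.IsParityGame) :
    (G.disjUnion G.gsQuotient).IsGSBisimulation (fun x y => G.sumCls x = G.sumCls y) := by
  have hQ := isParityGame_gsQuotient hG
  have hD := isParityGame_disjUnion hG hQ
  have := hG.1
  have := hQ.1
  have hpre : ∀ C : G.GSClass, (Sum.inl ⁻¹' (G.sumCls ⁻¹' {C}) : Set V) = C.1 := fun C => by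
    ext v
    exact (mem_class_iff hG).symm
  have hpre' : ∀ C : G.GSClass, (Sum.inl ⁻¹' (G.sumCls ⁻¹' {C})ᶜ : Set V) = C.1ᶜ := fun C => by
    rw [Set.preimage_compl, hpre]
  refine ⟨⟨fun _ => rfl, Eq.symm, Eq.trans⟩, ?_, ?_, ?_⟩
  · have hp : ∀ x, (G.disjUnion G.gsQuotient).prio x = G.gsQuotient.prio (G.sumCls x) := by
      rintro (v | C)
      · exact (gsQuotient_prio hG ((mem_class_iff hG).2 rfl)).symm
      · rfl
    intro x y h
    rw [hp, hp, h]
  · rintro x y hxy _ ⟨c, rfl⟩ hne ⟨u, hu, he⟩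
    replace hu : G.sumCls c = G.sumCls u := hu
    rw [forces_iff hD]
    simp only [eqClass_sumCls] at hne ⊢
    rw [hu] at hne ⊢
    have hCD : G.sumCls x ≠ G.sumCls u := fun h => hne (by rw [h])
    have hF : G.ClassForces ((G.disjUnion G.gsQuotient).owner x) (G.sumCls x) (G.sumCls u) := by
      cases he with
      | inl he =>
        exact classForces_of_edge hG ((mem_class_iff hG).2 rfl) ((mem_class_iff hG).2 rfl) he
      | inr he => exact classForces_owner hG hCD he
    rw [← hxy]
    obtain w | C := y
    · rw [← Set.mem_preimage, attr_disjUnion_inl, hpre, hpre]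
      exact hF w ((mem_class_iff hG).2 hxy.symm)
    · rw [← Set.mem_preimage, attr_disjUnion_inr]
      replace hxy : G.sumCls x = C := hxy
      rw [hxy] at hF hCD ⊢
      exact mem_attr_of_cpre rfl (cpre_mono subset_attr (hF.mem_cpre hG hCD))
  · have key : ∀ x j, (G.disjUnion G.gsQuotient).Diverges j x (G.sumCls ⁻¹' {G.sumCls x}) ↔
        G.ClassDiverges j (G.sumCls x) := by
      rintro (v | C) j
      · rw [diverges_iff hD, ← Set.mem_preimage, attr_disjUnion_inl, hpre, hpre']
        have hv : v ∈ (G.sumCls (.inl v)).1 := (mem_class_iff hG).2 rfl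
        exact ⟨classDiverges_of_mem hG hv, fun h => h v hv⟩
      · rw [diverges_iff hD, ← Set.mem_preimage, attr_disjUnion_inr]
        have := mem_attr_gsQuotient_iff hG (i := j.opp) (C := C)
        rw [Player.opp_opp] at this
        exact not_iff_comm.1 this.symm
    intro x y hxy j
    rw [eqClass_sumCls, eqClass_sumCls, key, key, hxy]
    exact id

theorem gsBisimilarBetween_gsQuotient (hG : G.IsParityGame) {v : V} {C : G.GSClass}
    (h : v ∈ C.1) : G.GSBisimilarBetween G.gsQuotient v C :=
  ⟨_, isGSBisimulation_sumCls hG, (mem_class_iff hG).1 h⟩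

end GameGraph
end ParityGames

/-! ### Mimicking a strategy in the quotient -/

namespace ParityGames

/-- The infinite sequence `p` falls apart into consecutive non-empty blocks, the `n`-th of which
consists of elements related to `q n`; the `n`-th block starts at index `l n`. -/
def BlockSim {V : Type u} {W : Type v} (r : V → W → Prop) (p : ℕ → V) (q : ℕ → W) : Prop :=
  ∃ l : ℕ → ℕ, StrictMono l ∧ l 0 = 0 ∧ ∀ n k, l n ≤ k → k < l (n + 1) → r (p k) (q n)

theorem exists_block {l : ℕ → ℕ} (hl : StrictMono l) (h0 : l 0 = 0) (k : ℕ) :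
    ∃ n, l n ≤ k ∧ k < l (n + 1) := by
  induction k with
  | zero => exact ⟨0, h0.le, by have := hl (Nat.lt_add_one 0); omega⟩
  | succ k ih =>
    obtain ⟨n, h1, h2⟩ := ih
    by_cases h : k + 1 < l (n + 1)
    · exact ⟨n, by omega, h⟩
    · have := hl (Nat.lt_add_one (n + 1))
      exact ⟨n + 1, by omega, by omega⟩

theorem BlockSim.mono {V : Type u} {W : Type v} {r s : V → W → Prop} {p : ℕ → V} {q : ℕ → W}
    (h : BlockSim r p q) (hrs : ∀ x y, r x y → s x y) : BlockSim s p q := by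
  obtain ⟨l, hl, h0, hr⟩ := h
  exact ⟨l, hl, h0, fun n k h1 h2 => hrs _ _ (hr n k h1 h2)⟩

theorem BlockSim.playEquiv {V : Type u} {W : Type v} {r : V → W → Prop} {p : ℕ → V} {q : ℕ → W}
    (h : BlockSim r p q) : PlayEquiv r p q := by
  obtain ⟨l, hl, h0, hr⟩ := h
  have key : ∀ k n, l n ≤ k → k < l (n + 1) → PathEquiv r (initSeg p k) (initSeg q n) := by
    intro k
    induction k with
    | zero =>
      intro n h1 h2
      obtain rfl : n = 0 := by
        have := hl.le_apply (x := n)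
        omega
      exact .single _ _ (hr 0 0 h1 h2)
    | succ k ih =>
      intro n h1 h2
      have hr' := hr n (k + 1) h1 h2
      rw [initSeg_succ]
      by_cases hk : l n ≤ k
      · exact .left _ _ _ _ (ih n hk (by omega)) (getLast?_initSeg q n) hr'
      · cases n with
        | zero => omega
        | succ n =>
          rw [initSeg_succ]
          have := hl (Nat.lt_add_one n)
          exact .both _ _ _ _ (ih n (by omega) (by omega)) hr'
  refine ⟨fun k => ?_, fun n => ⟨l n, key _ n le_rfl (hl (Nat.lt_add_one n))⟩⟩
  obtain ⟨n, h1, h2⟩ := exists_block hl h0 k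
  exact ⟨n, key k n h1 h2⟩

namespace GameGraph

variable {V : Type u} {G : GameGraph V} {i : Player}

theorem winsPlay_iff_of_blockSim {W : Type v} {H : GameGraph W} {p : ℕ → V} {q : ℕ → W}
    (h : BlockSim (fun x y => G.prio x = H.prio y) p q) :
    G.WinsPlay i p ↔ H.WinsPlay i q := by
  obtain ⟨l, hl, h0, hr⟩ := h
  have : ∀ m, (∃ᶠ k in Filter.atTop, G.prio (p k) = m) ↔
      ∃ᶠ k in Filter.atTop, H.prio (q k) = m := by
    intro m
    rw [Filter.frequently_atTop, Filter.frequently_atTop]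
    constructor
    · intro hf N
      obtain ⟨k, hk, hm⟩ := hf (l N)
      obtain ⟨n, h1, h2⟩ := exists_block hl h0 k
      have := hl.lt_iff_lt.1 (hk.trans_lt h2)
      exact ⟨n, by omega, by rw [← hr n k h1 h2, hm]⟩
    · intro hf N
      obtain ⟨n, hn, hm⟩ := hf N
      exact ⟨l n, hn.trans hl.le_apply, by rw [hr n _ le_rfl (hl (Nat.lt_add_one n)), hm]⟩
  simp only [WinsPlay, this]

/-- The initial segment `p 0, …, p n` is a path from `v` that is allowed by `σ`. -/
def Strategy.Follows (σ : G.Strategy i) (v : V) (p : ℕ → V) (n : ℕ) : Prop :=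
  p 0 = v ∧ ∀ k < n, G.edge (p k) (p (k + 1)) ∧
    ∀ u, σ.move (initSeg p k) = some u → p (k + 1) = u

theorem Strategy.Follows.snoc {σ : G.Strategy i} {v u : V} {p : ℕ → V} {n : ℕ}
    (h : σ.Follows v p n) (he : G.edge (p n) u)
    (hm : ∀ u', σ.move (initSeg p n) = some u' → u = u') :
    σ.Follows v (Function.update p (n + 1) u) (n + 1) := by
  have hagree : ∀ k ≤ n, Function.update p (n + 1) u k = p k := fun k hk =>
    Function.update_of_ne (by omega) _ _
  refine ⟨by rw [hagree 0 (Nat.zero_le _)]; exact h.1, fun k hk => ?_⟩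
  rw [hagree k (by omega), initSeg_congr fun j hj => hagree j (by omega)]
  obtain hk | rfl := Nat.lt_succ_iff_lt_or_eq.1 hk
  · rw [hagree (k + 1) (by omega)]
    exact h.2 k hk
  · rw [Function.update_self]
    exact ⟨he, hm⟩

/-- Whatever the strategy `σ` does, the opponent can make the play move into `X` if its last
vertex is among the controllable predecessors of `X`. -/
theorem Strategy.Follows.exists_step (ht : ∀ v, ∃ w, G.edge v w) {σ : G.Strategy i} {v : V}
    {p : ℕ → V} {n : ℕ} (h : σ.Follows v p n) {X : Set V} (hX : p n ∈ G.cpre i.opp X) :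
    ∃ p', (∀ k ≤ n, p' k = p k) ∧ σ.Follows v p' (n + 1) ∧ p' (n + 1) ∈ X := by
  have key : ∃ u ∈ X, G.edge (p n) u ∧ ∀ u', σ.move (initSeg p n) = some u' → u = u' := by
    obtain ⟨ho, u, hu, he⟩ | ⟨-, hall⟩ := hX
    · have hne : G.owner (p n) ≠ i := by rw [ho]; exact i.opp_ne
      exact ⟨u, hu, he, by simp [Strategy.move_eq_none hne]⟩
    · cases hm : σ.move (initSeg p n) with
      | none =>
        obtain ⟨u, he⟩ := ht (p n)
        exact ⟨u, hall u he, he, by simp⟩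
      | some u =>
        have he := Strategy.edge_of_move hm
        exact ⟨u, hall u he, he, by simp⟩
  obtain ⟨u, hu, he, hm⟩ := key
  exact ⟨_, fun k hk => Function.update_of_ne (by omega) _ _, h.snoc he hm,
    by rwa [Function.update_self]⟩

theorem Strategy.Follows.exists_reach (ht : ∀ v, ∃ w, G.edge v w) {σ : G.Strategy i} {v : V}
    {p : ℕ → V} {n : ℕ} (h : σ.Follows v p n) {U T : Set V} (hT : p n ∈ G.attr i.opp U T) :
    ∃ p' n', n ≤ n' ∧ (∀ k ≤ n, p' k = p k) ∧ σ.Follows v p' n' ∧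
      (∀ k, n ≤ k → k < n' → p' k ∈ U) ∧ p' n' ∈ T := by
  refine attr_induction (P := fun x => ∀ p n, σ.Follows v p n → p n = x →
    ∃ p' n', n ≤ n' ∧ (∀ k ≤ n, p' k = p k) ∧ σ.Follows v p' n' ∧
      (∀ k, n ≤ k → k < n' → p' k ∈ U) ∧ p' n' ∈ T) ?_ ?_ hT p n h rfl
  · rintro _ hx p n h rfl
    exact ⟨p, n, le_rfl, fun _ _ => rfl, h, fun k h1 h2 => by omega, hx⟩
  · rintro _ hU hc p n h rfl
    obtain ⟨p₁, ha₁, h₁, -, hx⟩ := h.exists_step ht hc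
    obtain ⟨p₂, n₂, hn, ha₂, h₂, hU₂, hT₂⟩ := hx p₁ (n + 1) h₁ rfl
    have ha : ∀ k ≤ n, p₂ k = p k := fun k hk => (ha₂ k (by omega)).trans (ha₁ k hk)
    refine ⟨p₂, n₂, by omega, ha, h₂, fun k h1 h2 => ?_, hT₂⟩
    obtain rfl | h1 := eq_or_lt_of_le h1
    · rw [ha n le_rfl]
      exact hU
    · exact hU₂ k h1 h2

/-- The history `t` prolongs the history `s` by at least one vertex, in accordance with the
strategy `σ`: it remains in the class `C` and ends in the class `D`. A history `(p, n)` stands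
for the finite path `p 0, …, p n`. -/
def Strategy.Extends (σ : G.Strategy i) (v : V) (C D : G.GSClass) (s t : (ℕ → V) × ℕ) : Prop :=
  s.2 < t.2 ∧ (∀ k ≤ s.2, t.1 k = s.1 k) ∧ σ.Follows v t.1 t.2 ∧
    (∀ k, s.2 ≤ k → k < t.2 → t.1 k ∈ C.1) ∧ t.1 t.2 ∈ D.1

theorem Strategy.Follows.exists_extends_of_forces (hG : G.IsParityGame) {σ : G.Strategy i}
    {v : V} {s : (ℕ → V) × ℕ} (h : σ.Follows v s.1 s.2) {C D : G.GSClass} (hCD : C ≠ D)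
    (hC : s.1 s.2 ∈ C.1) (hF : G.ClassForces i.opp C D) : ∃ t, σ.Extends v C D s t := by
  obtain ⟨p, n, h1, h2, h3, h4, h5⟩ := h.exists_reach hG.2 (hF _ hC)
  refine ⟨(p, n), lt_of_le_of_ne h1 ?_, h2, h3, h4, h5⟩
  rintro rfl
  rw [h2 _ le_rfl] at h5
  exact (disjoint_class hG hCD).le_bot ⟨hC, h5⟩

theorem Strategy.Follows.exists_extends_self (hG : G.IsParityGame) {σ : G.Strategy i}
    {v : V} {s : (ℕ → V) × ℕ} (h : σ.Follows v s.1 s.2) {C : G.GSClass}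
    (hC : s.1 s.2 ∈ C.1) (hD : G.ClassDiverges i.opp C) : ∃ t, σ.Extends v C C s t := by
  have := hG.1
  have hc := mem_cpre_opp_of_notMem_attr hC (hD _ hC)
  rw [Player.opp_opp] at hc
  obtain ⟨p, h1, h2, h3⟩ := h.exists_step hG.2
    (cpre_mono (Set.compl_subset_comm.1 subset_attr) hc)
  have hp : p s.2 ∈ C.1 := (h1 _ le_rfl).symm ▸ hC
  have hin : ∀ k, s.2 ≤ k → k < s.2 + 1 → p k ∈ C.1 := fun k hk hk' => by
    obtain rfl : k = s.2 := by omega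
    exact hp
  exact ⟨(p, s.2 + 1), Nat.lt_succ_self _, h1, h2, hin, h3⟩

/-- Every move of the opponent in the quotient can be followed by prolonging a `σ`-history. -/
theorem Strategy.Follows.exists_extends_of_edge (hG : G.IsParityGame) {σ : G.Strategy i}
    {v : V} {s : (ℕ → V) × ℕ} (h : σ.Follows v s.1 s.2) {C D : G.GSClass}
    (hC : s.1 s.2 ∈ C.1) (ho : G.gsQuotient.owner C ≠ i) (he : G.gsQuotient.edge C D) :
    ∃ t, σ.Extends v C D s t := by
  rw [Player.ne_iff] at ho
  by_cases hCD : C = D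
  · subst hCD
    exact h.exists_extends_self hG hC (ho ▸ classDiverges_owner hG he)
  · exact h.exists_extends_of_forces hG hCD hC (ho ▸ classForces_owner hG hCD he)

/-- Every `σ`-history can be prolonged in accordance with some move in the quotient. -/
theorem Strategy.Follows.exists_edge_extends (hG : G.IsParityGame) {σ : G.Strategy i}
    {v : V} {s : (ℕ → V) × ℕ} (h : σ.Follows v s.1 s.2) {C : G.GSClass}
    (hC : s.1 s.2 ∈ C.1) : ∃ D, G.gsQuotient.edge C D ∧ ∃ t, σ.Extends v C D s t := by
  have := hG.1
  -- If the opponent can force the play out of `C`, the move of the quotient is chosen to be the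
  -- exit that he then reaches; otherwise any single step that `σ` allows will do.
  by_cases hx : s.1 s.2 ∈ G.attr i.opp C.1 C.1ᶜ
  · obtain ⟨p, n, h1, h2, h3, h4, h5⟩ := h.exists_reach hG.2 hx
    have hn : s.2 < n := by
      refine lt_of_le_of_ne h1 ?_
      rintro rfl
      rw [h2 _ le_rfl] at h5
      exact h5 hC
    have hD : p n ∈ (G.cls (p n)).1 := (mem_class_iff hG).2 rfl
    refine ⟨G.cls (p n), ?_, (p, n), hn, h2, h3, h4, hD⟩
    have he := (h3.2 (n - 1) (by omega)).1
    rw [Nat.sub_add_cancel (by omega)] at he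
    exact gsQuotient_edge_of_edge hG (fun hc => h5 (hc ▸ hD)) (h4 (n - 1) (by omega) (by omega))
      hD he
  · have hd : G.ClassDiverges i C := classDiverges_of_mem hG hC hx
    have hstep : s.1 s.2 ∈ G.cpre i.opp Set.univ := by
      by_cases ho : G.owner (s.1 s.2) = i.opp
      · obtain ⟨w, hw⟩ := hG.2 (s.1 s.2)
        exact Or.inl ⟨ho, w, trivial, hw⟩
      · exact Or.inr ⟨ho, fun _ _ => trivial⟩
    obtain ⟨p, h1, h2, -⟩ := h.exists_step hG.2 hstep
    have hp : p s.2 ∈ C.1 := (h1 _ le_rfl).symm ▸ hC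
    have hin : ∀ k, s.2 ≤ k → k < s.2 + 1 → p k ∈ C.1 := fun k hk hk' => by
      obtain rfl : k = s.2 := by omega
      exact hp
    have hD : p (s.2 + 1) ∈ (G.cls (p (s.2 + 1))).1 := (mem_class_iff hG).2 rfl
    refine ⟨G.cls (p (s.2 + 1)), ?_, (p, s.2 + 1), Nat.lt_succ_self _, h1, h2, hin, hD⟩
    by_cases hCD : C = G.cls (p (s.2 + 1))
    · rw [← hCD]
      exact gsQuotient_edge_self hG hd
    · exact gsQuotient_edge_of_edge hG hCD hp hD (h2.2 s.2 (by omega)).1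

open Classical in
/-- The prolongation of a `σ`-history by which a move to the class `D` in the quotient is
answered. -/
noncomputable def Strategy.respond (σ : G.Strategy i) (v : V) (s : (ℕ → V) × ℕ)
    (D : G.GSClass) : (ℕ → V) × ℕ :=
  if h : ∃ t, σ.Extends v (G.cls (s.1 s.2)) D s t then h.choose else s

open Classical in
/-- A class to which the owner of `σ` can safely move in the quotient after a `σ`-history. -/
noncomputable def Strategy.target (σ : G.Strategy i) (v : V) (s : (ℕ → V) × ℕ) : G.GSClass :=
  if h : ∃ D, G.gsQuotient.edge (G.cls (s.1 s.2)) D ∧ ∃ t, σ.Extends v (G.cls (s.1 s.2)) D s t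
  then h.choose else G.cls (s.1 s.2)

/-- The `σ`-history that is maintained along a path of the quotient that starts in the class
of `v`. -/
noncomputable def Strategy.shadow (σ : G.Strategy i) (v : V) (q : List G.GSClass) :
    (ℕ → V) × ℕ :=
  q.tail.foldl (σ.respond v) (fun _ => v, 0)

open Classical in
/-- The strategy in the quotient that mimics the strategy `σ`. -/
noncomputable def Strategy.quotientStrategy (σ : G.Strategy i) (v : V) :
    G.gsQuotient.Strategy i where
  move q := if G.gsQuotient.IsPath q ∧ ∃ C, q.getLast? = some C ∧ G.gsQuotient.owner C = i ∧
      G.gsQuotient.edge C (σ.target v (σ.shadow v q))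
    then some (σ.target v (σ.shadow v q)) else none
  legal q u hu := by
    split_ifs at hu with hc
    rw [Option.some.injEq] at hu
    rwa [hu] at hc

theorem Strategy.shadow_initSeg_succ (σ : G.Strategy i) (v : V) (q : ℕ → G.GSClass) (n : ℕ) :
    σ.shadow v (initSeg q (n + 1)) = σ.respond v (σ.shadow v (initSeg q n)) (q (n + 1)) := by
  have h : initSeg q n ≠ [] := by simp [initSeg]
  rw [Strategy.shadow, Strategy.shadow, initSeg_succ, List.tail_append_of_ne_nil h,
    List.foldl_append]
  rfl

/-- The `σ`-histories maintained along a play of the mimicking strategy prolong each other. -/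
theorem Strategy.extends_shadow (hG : G.IsParityGame) {σ : G.Strategy i} {v : V} {C : G.GSClass}
    (hv : v ∈ C.1) {q : ℕ → G.GSClass} (hq : q ∈ (σ.quotientStrategy v).plays C) (n : ℕ) :
    σ.Extends v (q n) (q (n + 1)) (σ.shadow v (initSeg q n)) (σ.shadow v (initSeg q (n + 1))) := by
  have key : ∀ n, σ.Follows v (σ.shadow v (initSeg q n)).1 (σ.shadow v (initSeg q n)).2 →
      (σ.shadow v (initSeg q n)).1 (σ.shadow v (initSeg q n)).2 ∈ (q n).1 →
      σ.Extends v (q n) (q (n + 1)) (σ.shadow v (initSeg q n))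
        (σ.shadow v (initSeg q (n + 1))) := by
    intro n h hn
    rw [σ.shadow_initSeg_succ]
    set s := σ.shadow v (initSeg q n) with hs
    have hcls : G.cls (s.1 s.2) = q n := (mem_class_iff hG).1 hn
    have hex : ∃ t, σ.Extends v (q n) (q (n + 1)) s t := by
      by_cases ho : G.gsQuotient.owner (q n) = i
      · have ht := h.exists_edge_extends hG hn
        have htgt : G.gsQuotient.edge (q n) (σ.target v s) ∧
            ∃ t, σ.Extends v (q n) (σ.target v s) s t := by
          rw [Strategy.target, hcls, dif_pos ht]
          exact ht.choose_spec
        have hmove : (σ.quotientStrategy v).move (initSeg q n) = some (σ.target v s) := by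
          rw [Strategy.quotientStrategy]
          exact if_pos ⟨isPath_initSeg fun k _ => hq.1.2 k, q n, getLast?_initSeg q n, ho,
            htgt.1⟩
        rw [hq.2 n _ hmove]
        exact htgt.2
      · exact h.exists_extends_of_edge hG hn ho (hq.1.2 n)
    rw [Strategy.respond, hcls, dif_pos hex]
    exact hex.choose_spec
  suffices h : σ.Follows v (σ.shadow v (initSeg q n)).1 (σ.shadow v (initSeg q n)).2 ∧
      (σ.shadow v (initSeg q n)).1 (σ.shadow v (initSeg q n)).2 ∈ (q n).1 from key n h.1 h.2
  induction n with
  | zero => exact ⟨⟨rfl, fun k hk => absurd hk (Nat.not_lt_zero k)⟩, hq.1.1.symm ▸ hv⟩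
  | succ n ih =>
    obtain ⟨-, -, h1, -, h2⟩ := key n ih.1 ih.2
    exact ⟨h1, h2⟩

/-- Every play of the mimicking strategy is, block by block, the sequence of classes of a play that
`σ` allows. -/
theorem Strategy.exists_blockSim (hG : G.IsParityGame) {σ : G.Strategy i} {v : V}
    {C : G.GSClass} (hv : v ∈ C.1) {q : ℕ → G.GSClass}
    (hq : q ∈ (σ.quotientStrategy v).plays C) :
    ∃ p ∈ σ.plays v, BlockSim (fun x (D : G.GSClass) => x ∈ D.1) p q := by
  have hext := Strategy.extends_shadow hG hv hq
  set S : ℕ → (ℕ → V) × ℕ := fun n => σ.shadow v (initSeg q n) with hS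
  have hmono : StrictMono fun n => (S n).2 := strictMono_nat_of_lt_succ fun n => (hext n).1
  have hagree : ∀ n m, n ≤ m → ∀ k ≤ (S n).2, (S m).1 k = (S n).1 k := by
    intro n m hnm
    induction hnm with
    | refl => exact fun _ _ => rfl
    | step hnm ih =>
      intro k hk
      rw [← ih k hk]
      exact (hext _).2.1 k (hk.trans (hmono.monotone hnm))
  -- The limit play is the diagonal `k ↦ (S k).1 k`; it agrees with every history `S n`.
  have hp : ∀ n k, k ≤ (S n).2 → (S k).1 k = (S n).1 k := by
    intro n k hk
    obtain h | h := le_total n k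
    · exact hagree n k h k hk
    · exact (hagree k n h k hmono.le_apply).symm
  have hfol : ∀ n, σ.Follows v (S (n + 1)).1 (S (n + 1)).2 := fun n => (hext n).2.2.1
  have hlt : ∀ k, k + 1 ≤ (S (k + 1)).2 := fun k => hmono.le_apply
  have hstep : ∀ k, G.edge ((S k).1 k) ((S (k + 1)).1 (k + 1)) ∧
      ∀ u, σ.move (initSeg (fun k => (S k).1 k) k) = some u → (S (k + 1)).1 (k + 1) = u := by
    intro k
    have hk := hlt k
    rw [hp (k + 1) k (by omega), initSeg_congr fun j hj => hp (k + 1) j (by omega)]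
    exact (hfol k).2 k hk
  refine ⟨fun k => (S k).1 k, ⟨⟨rfl, fun k => (hstep k).1⟩, fun k => (hstep k).2⟩,
    fun n => (S n).2, hmono, rfl, fun n k h1 h2 => ?_⟩
  dsimp only
  rw [hp (n + 1) k h2.le]
  exact (hext n).2.2.2.1 k h1 h2

end GameGraph
end ParityGames

/-! ### Positional determinacy -/

namespace ParityGames
namespace GameGraph

variable {V : Type u} {G : GameGraph V} {i : Player}

theorem winsPlay_shift {p : ℕ → V} (n : ℕ) (h : G.WinsPlay i fun k => p (k + n)) :
    G.WinsPlay i p := by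
  have : ∀ m, (∃ᶠ k in Filter.atTop, G.prio (p (k + n)) = m) ↔
      ∃ᶠ k in Filter.atTop, G.prio (p k) = m := by
    intro m
    conv_rhs => rw [← Filter.map_add_atTop_eq_nat n, Filter.frequently_map]
  simpa only [WinsPlay, this] using h

/-- The game in which only the edges into `A` are retained. -/
def restrict (G : GameGraph V) (A : Set V) : GameGraph V :=
  { G with edge := fun v w => G.edge v w ∧ w ∈ A }

/-- `W` is a part of the winning region of player `i` in the subgame on `A`: a positional strategy
of `i` keeps the play in `W` and wins it, provided that the play does not leave `A`. -/
def Region (G : GameGraph V) (i : Player) (A W : Set V) : Prop :=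
  W ⊆ A ∧ ∃ f : V → V, (∀ v ∈ W, G.owner v = i → G.edge v (f v) ∧ f v ∈ W) ∧
    (∀ v ∈ W, G.owner v ≠ i → ∀ u ∈ A, G.edge v u → u ∈ W) ∧
    ∀ p : ℕ → V, (∀ k, p k ∈ W) → (∀ k, G.edge (p k) (p (k + 1))) →
      (∀ k, G.owner (p k) = i → p (k + 1) = f (p k)) → G.WinsPlay i p

/-- The subgame on `A` is positionally determined. -/
def Determined (G : GameGraph V) (A : Set V) : Prop :=
  ∃ W : Player → Set V, (∀ v ∈ A, ∃ i, v ∈ W i) ∧ ∀ i, G.Region i A (W i)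

theorem Region.determined {A W W' : Set V} (h : G.Region i A W) (h' : G.Region i.opp A W')
    (hA : ∀ v ∈ A, v ∈ W ∨ v ∈ W') : G.Determined A := by
  classical
  refine ⟨fun j => if j = i then W else W', fun v hv => ?_, fun j => ?_⟩
  · obtain hv | hv := hA v hv
    · exact ⟨i, by simpa using hv⟩
    · exact ⟨i.opp, by simpa [i.opp_ne] using hv⟩
  · dsimp only
    split_ifs with hj
    · exact hj ▸ h
    · exact Player.ne_iff.1 hj ▸ h'

theorem Region.empty (G : GameGraph V) (i : Player) (A : Set V) : G.Region i A ∅ :=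
  ⟨Set.empty_subset _, id, fun _ h => h.elim, fun _ h => h.elim, fun _ h => (h 0).elim⟩

/-- A subgame that the opponent cannot leave has the same winning region inside the whole game. -/
theorem Region.of_trap {A B W : Set V} (h : G.Region i B W) (hBA : B ⊆ A)
    (hB : ∀ v ∈ B, G.owner v ≠ i → ∀ u ∈ A, G.edge v u → u ∈ B) : G.Region i A W := by
  obtain ⟨hW, f, h1, h2, h3⟩ := h
  exact ⟨hW.trans hBA, f, h1,
    fun v hv ho u hu he => h2 v hv ho u (hB v (hW hv) ho u hu he) he, h3⟩

theorem attr_subset_union {U T : Set V} : G.attr i U T ⊆ U ∪ T := fun _ h =>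
  (attr_cases h).elim Or.inr fun h => Or.inl h.1

/-- The complement of an attractor is a trap for the attracting player. -/
theorem notMem_attr_of_edge [Finite V] {A T : Set V} {v u : V} (hv : v ∈ A)
    (hv' : v ∉ (G.restrict A).attr i A T) (ho : G.owner v = i) (hu : u ∈ A)
    (he : G.edge v u) : u ∉ (G.restrict A).attr i A T :=
  fun hu' => hv' (mem_attr_of_cpre hv (Or.inl ⟨ho, u, hu', he, hu⟩))

theorem exists_edge_diff_attr [Finite V] {A T : Set V} (hA : ∀ v ∈ A, ∃ w ∈ A, G.edge v w)
    {v : V} (hv : v ∈ A \ (G.restrict A).attr i A T) :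
    ∃ w ∈ A \ (G.restrict A).attr i A T, G.edge v w := by
  obtain ⟨-, w, hw, he, hwA⟩ | ⟨-, h⟩ := mem_cpre_opp_of_notMem_attr hv.1 hv.2
  · exact ⟨w, ⟨hwA, hw⟩, he⟩
  · obtain ⟨w, hw, he⟩ := hA v hv.1
    exact ⟨w, ⟨hw, h w ⟨he, hw⟩⟩, he⟩

/-- If the least priority is good for player `i`, and `i` wins everywhere outside the attractor of
the vertices with that priority, then `i` wins everywhere: either the least priority is seen
infinitely often, or the play eventually remains outside the attractor. -/
theorem Region.of_least_prio {A : Set V} (hA : ∀ v ∈ A, ∃ w ∈ A, G.edge v w) {m : ℕ}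
    (hm : ∀ v ∈ A, m ≤ G.prio v) (hi : Even m ↔ i = .even)
    (h : G.Region i (A \ (G.restrict A).attr i A {v ∈ A | G.prio v = m})
      (A \ (G.restrict A).attr i A {v ∈ A | G.prio v = m})) : G.Region i A A := by
  classical
  set N := {v ∈ A | G.prio v = m} with hN
  set X := (G.restrict A).attr i A N with hX
  have hg : ∀ v, ∃ w, v ∈ A → w ∈ A ∧ G.edge v w := fun v => by
    by_cases hv : v ∈ A
    · obtain ⟨w, hw⟩ := hA v hv
      exact ⟨w, fun _ => hw⟩
    · exact ⟨v, fun h => absurd h hv⟩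
  choose g hg using hg
  obtain ⟨fX, r, hf⟩ := (G.restrict A).exists_attr_rank i A N
  obtain ⟨-, f, h1, -, h3⟩ := h
  refine ⟨subset_rfl, fun v => if v ∈ N then g v else if v ∈ X then fX v else f v, ?_,
    fun _ _ _ u hu _ => hu, fun p hp he hstr => ?_⟩
  · intro v hv ho
    dsimp only
    split_ifs with hvN hvX
    · exact (hg v hv).symm
    · exact ((hf v hvX hvN).2.1 ho).1
    · exact ⟨(h1 v ⟨hv, hvX⟩ ho).1, (h1 v ⟨hv, hvX⟩ ho).2.1⟩
  · dsimp only at hstr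
    by_cases hinf : ∀ K, ∃ k ≥ K, p k ∈ N
    · refine ⟨m, ⟨Filter.frequently_atTop.2 fun K => ?_, fun n hn => ?_⟩, hi⟩
      · obtain ⟨k, hk, hkN⟩ := hinf K
        exact ⟨k, hk, hkN.2⟩
      · obtain ⟨k, hk⟩ := Filter.Frequently.exists hn
        exact hk ▸ hm _ (hp k)
    · push Not at hinf
      obtain ⟨K, hK⟩ := hinf
      have hout : ∀ k ≥ K, p k ∉ X := by
        intro k hk hkX
        obtain ⟨n, hn, hnN, -⟩ := exists_reach_of_rank hf (fun k => ⟨he k, hp (k + 1)⟩)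
          (fun k hkX hkN ho => by rw [hstr k ho, if_neg hkN, if_pos hkX]) hkX
        exact hK n (hk.trans hn) hnN
      refine winsPlay_shift K (h3 _ (fun k => ⟨hp _, hout _ (by omega)⟩)
        (fun k => ?_) fun k ho => ?_)
      · rw [Nat.add_right_comm]
        exact he _
      · rw [Nat.add_right_comm, hstr _ ho, if_neg (hK (k + K) (by omega)),
          if_neg (hout (k + K) (by omega))]

/-- A winning region can be enlarged by its attractor and by a winning region of what remains. -/
theorem Region.attr_union {A W W' : Set V} (h : G.Region i A W)
    (h' : G.Region i (A \ (G.restrict A).attr i A W) W') :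
    G.Region i A ((G.restrict A).attr i A W ∪ W') := by
  classical
  set Y := (G.restrict A).attr i A W with hY
  obtain ⟨fY, r, hf⟩ := (G.restrict A).exists_attr_rank i A W
  obtain ⟨hWA, f, h1, h2, h3⟩ := h
  obtain ⟨hWA', f', h1', h2', h3'⟩ := h'
  have hWY : W ⊆ Y := subset_attr
  have hYA : Y ⊆ A := attr_subset_union.trans (Set.union_subset subset_rfl hWA)
  have hsub : Y ∪ W' ⊆ A := Set.union_subset hYA (hWA'.trans Set.sdiff_subset)
  refine ⟨hsub, fun v => if v ∈ W then f v else if v ∈ Y then fY v else f' v, ?_, ?_,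
    fun p hp he hstr => ?_⟩
  · intro v hv ho
    dsimp only
    split_ifs with hvW hvY
    · exact ⟨(h1 v hvW ho).1, Or.inl (hWY (h1 v hvW ho).2)⟩
    · obtain ⟨h5, h6, -⟩ := (hf v hvY hvW).2.1 ho
      exact ⟨h5.1, Or.inl h6⟩
    · have hv' := hv.resolve_left hvY
      exact ⟨(h1' v hv' ho).1, Or.inr (h1' v hv' ho).2⟩
  · intro v hv ho u hu he
    by_cases hvW : v ∈ W
    · exact Or.inl (hWY (h2 v hvW ho u hu he))
    · by_cases hvY : v ∈ Y
      · exact Or.inl ((hf v hvY hvW).2.2 ho u ⟨he, hu⟩).1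
      · by_cases huY : u ∈ Y
        · exact Or.inl huY
        · exact Or.inr (h2' v (hv.resolve_left hvY) ho u ⟨hu, huY⟩ he)
  · dsimp only at hstr
    by_cases hk : ∃ k, p k ∈ Y
    · obtain ⟨k, hk⟩ := hk
      obtain ⟨n, -, hn, -⟩ := exists_reach_of_rank hf (fun k => ⟨he k, hsub (hp (k + 1))⟩)
        (fun k hkY hkW ho => by rw [hstr k ho, if_neg hkW, if_pos hkY]) hk
      have hin : ∀ k, p (k + n) ∈ W := by
        intro k
        induction k with
        | zero => rwa [Nat.zero_add]
        | succ k ih =>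
          rw [Nat.add_right_comm]
          by_cases ho : G.owner (p (k + n)) = i
          · rw [hstr _ ho, if_pos ih]
            exact (h1 _ ih ho).2
          · exact h2 _ ih ho _ (hsub (hp _)) (he _)
      refine winsPlay_shift n (h3 _ hin (fun k => ?_) fun k ho => ?_)
      · rw [Nat.add_right_comm]
        exact he _
      · rw [Nat.add_right_comm, hstr _ ho, if_pos (hin k)]
    · push Not at hk
      exact h3' p (fun k => (hp k).resolve_left (hk k)) he fun k ho => by
        rw [hstr k ho, if_neg fun h => hk k (hWY h), if_neg (hk k)]

/-- Positional determinacy of finite parity games, by Zielonka's recursion on subgames. -/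
theorem determined [Finite V] (A : Set V) (hA : ∀ v ∈ A, ∃ w ∈ A, G.edge v w) :
    G.Determined A := by
  induction hn : A.ncard using Nat.strong_induction_on generalizing A with
  | _ n ih =>
  subst hn
  obtain rfl | hne := A.eq_empty_or_nonempty
  · exact (Region.empty G .even ∅).determined (Region.empty G _ ∅) fun v hv => hv.elim
  have hrec : ∀ B ⊆ A, B.Nonempty → (∀ v ∈ A \ B, ∃ w ∈ A \ B, G.edge v w) →
      G.Determined (A \ B) := fun B hB hBne hB' =>
    ih _ (Set.ncard_lt_ncard ⟨Set.sdiff_subset, fun h =>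
      hBne.elim fun b hb => (h (hB hb)).2 hb⟩) _ hB' rfl
  obtain ⟨a, ha, hmin⟩ := A.exists_min_image G.prio A.toFinite hne
  obtain ⟨i, hi⟩ : ∃ i : Player, Even (G.prio a) ↔ i = .even := by
    by_cases h : Even (G.prio a)
    · exact ⟨.even, by simpa⟩
    · exact ⟨.odd, iff_of_false h nofun⟩
  have hNA : {v ∈ A | G.prio v = G.prio a} ⊆ A := fun _ h => h.1
  have hsub : ∀ (j : Player) (T : Set V), T ⊆ A → (G.restrict A).attr j A T ⊆ A :=
    fun j T hT => attr_subset_union.trans (Set.union_subset subset_rfl hT)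
  obtain ⟨W, hW, hreg⟩ := hrec ((G.restrict A).attr i A {v ∈ A | G.prio v = G.prio a})
    (hsub i _ hNA) ⟨a, subset_attr ⟨ha, rfl⟩⟩ fun v hv => exists_edge_diff_attr hA hv
  obtain hW' | hW' := (W i.opp).eq_empty_or_nonempty
  · have hWi : W i = A \ (G.restrict A).attr i A {v ∈ A | G.prio v = G.prio a} := by
      refine (hreg i).1.antisymm fun v hv => ?_
      obtain ⟨j, hj⟩ := hW v hv
      by_cases hji : j = i
      · exact hji ▸ hj
      · rw [Player.ne_iff.1 hji, hW'] at hj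
        exact hj.elim
    have h := hreg i
    rw [hWi] at h
    exact (h.of_least_prio hA hmin hi).determined (Region.empty G _ A) fun _ => Or.inl
  · have h : G.Region i.opp A (W i.opp) := (hreg i.opp).of_trap Set.sdiff_subset
      fun v hv ho u hu he =>
        ⟨hu, notMem_attr_of_edge hv.1 hv.2 (Player.ne_opp_iff.1 ho) hu he⟩
    obtain ⟨W₂, hW₂, hreg₂⟩ := hrec ((G.restrict A).attr i.opp A (W i.opp))
      (hsub _ _ h.1) (hW'.mono subset_attr) fun v hv => exists_edge_diff_attr hA hv
    have h₂ : G.Region i A (W₂ i) := (hreg₂ i).of_trap Set.sdiff_subset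
      fun v hv ho u hu he => ⟨hu, notMem_attr_of_edge hv.1 hv.2 (Player.ne_iff.1 ho) hu he⟩
    refine h₂.determined (h.attr_union (hreg₂ i.opp)) fun v hv => ?_
    by_cases hvY : v ∈ (G.restrict A).attr i.opp A (W i.opp)
    · exact Or.inr (Or.inl hvY)
    · obtain ⟨j, hj⟩ := hW₂ v ⟨hv, hvY⟩
      by_cases hji : j = i
      · exact Or.inl (hji ▸ hj)
      · exact Or.inr (Or.inr (Player.ne_iff.1 hji ▸ hj))

/-! ### Bisimilar vertices have the same winner -/

theorem exists_wonBy (hG : G.IsParityGame) (v : V) : ∃ i, G.WonBy i v := by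
  have := hG.1
  obtain ⟨W, hW, hreg⟩ := determined (G := G) Set.univ fun v _ => by simpa using hG.2 v
  obtain ⟨i, hi⟩ := hW v trivial
  obtain ⟨-, f, h1, h2, h3⟩ := hreg i
  refine ⟨i, G.posStrategy i f (W i) fun x hx ho => (h1 x hx ho).1, fun p hp => ?_⟩
  have hin : ∀ k, p k ∈ W i := by
    intro k
    induction k with
    | zero => rwa [hp.1.1]
    | succ k ih =>
      by_cases ho : G.owner (p k) = i
      · rw [posStrategy_follows hp ih ho]
        exact (h1 _ ih ho).2
      · exact h2 _ ih ho _ trivial (hp.1.2 k)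
  exact h3 p hin hp.1.2 fun k ho => posStrategy_follows hp (hin k) ho

theorem WonBy.not_opp (hG : G.IsParityGame) {v : V} (h : G.WonBy i v) : ¬ G.WonBy i.opp v := by
  rintro ⟨τ, hτ⟩
  obtain ⟨σ, hσ⟩ := h
  obtain ⟨p, h1, h2⟩ := exists_mem_plays_inter hG.2 σ τ v
  obtain ⟨n, hn, hn'⟩ := hσ p h1
  obtain ⟨m, hm, hm'⟩ := hτ p h2
  rw [hm.unique hn, hn'] at hm'
  cases i <;> simp [Player.opp] at hm'

theorem WonBy.gsQuotient (hG : G.IsParityGame) {v : V} (h : G.WonBy i v) :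
    G.gsQuotient.WonBy i (G.cls v) := by
  obtain ⟨σ, hσ⟩ := h
  refine ⟨σ.quotientStrategy v, fun q hq => ?_⟩
  obtain ⟨p, hp, hpq⟩ := Strategy.exists_blockSim hG ((mem_class_iff hG).2 rfl) hq
  exact (winsPlay_iff_of_blockSim (hpq.mono fun x D h => (gsQuotient_prio hG h).symm)).1 (hσ p hp)

theorem GSBisimilar.winnerEquivalent (hG : G.IsParityGame) {v w : V} (h : G.GSBisimilar v w) :
    G.WinnerEquivalent v w := by
  obtain ⟨i, hi⟩ := exists_wonBy hG v
  obtain ⟨j, hj⟩ := exists_wonBy hG w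
  by_cases hji : j = i
  · exact ⟨i, hi, hji ▸ hj⟩
  · have hvw : G.cls v = G.cls w :=
      (mem_class_iff hG).1 (class_invariant hG _ w v h.symm ((mem_class_iff hG).2 rfl))
    have hj' := hj.gsQuotient hG
    rw [← hvw, Player.ne_iff.1 hji] at hj'
    exact absurd hj' ((hi.gsQuotient hG).not_opp (isParityGame_gsQuotient hG))

/-! ### Winner equivalence is coarser than bisimilarity -/

/-- The game with two vertices, each with a loop as its only edge, and the priorities `0` and `2`:
even wins from both vertices, but they have different priorities. -/
def twoLoops : GameGraph Bool where
  edge v w := v = w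
  prio v := if v then 2 else 0
  owner _ := .even

theorem isParityGame_twoLoops : twoLoops.IsParityGame := ⟨inferInstance, fun v => ⟨v, rfl⟩⟩

theorem wonBy_twoLoops (v : Bool) : twoLoops.WonBy .even v := by
  refine ⟨twoLoops.posStrategy .even id ∅ (by simp), fun p hp => ?_⟩
  have hc : ∀ k, p k = v := by
    intro k
    induction k with
    | zero => exact hp.1.1
    | succ k ih => exact (hp.1.2 k).symm.trans ih
  refine ⟨twoLoops.prio v, ⟨?_, fun m hm => ?_⟩, ?_⟩
  · simp [hc]
  · obtain ⟨k, hk⟩ := Filter.Frequently.exists hm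
    rw [← hk, hc]
  · cases v <;> simp [twoLoops]

end GameGraph
end ParityGames

theorem mainTheorem2 :
    (∀ (V : Type u) (G : ParityGames.GameGraph V), G.IsParityGame →
      Equivalence G.GSBisimilar ∧
      G.gsQuotient.IsParityGame ∧
      (∀ (v : V) (C : G.GSClass), v ∈ C.1 →
        ∀ (i : ParityGames.Player) (σ : G.Strategy i),
          ∃ ψ : G.gsQuotient.Strategy i, ∀ q ∈ ψ.plays C, ∃ p ∈ σ.plays v,
            ParityGames.PlayEquiv (G.GSBisimilarBetween G.gsQuotient) p q) ∧
      (∀ v w : V, G.GSBisimilar v w → G.WinnerEquivalent v w)) ∧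
    (∃ (V : Type) (G : ParityGames.GameGraph V), G.IsParityGame ∧
      ∃ v w : V, G.WinnerEquivalent v w ∧ ¬ G.GSBisimilar v w) := by
  open ParityGames GameGraph in
  refine ⟨fun V G hG => ⟨(isGSBisimulation_gsBisimilar hG).equivalence,
    isParityGame_gsQuotient hG, fun v C hv i σ => ⟨σ.quotientStrategy v, fun q hq => ?_⟩,
    fun v w h => h.winnerEquivalent hG⟩, Bool, twoLoops, isParityGame_twoLoops, false, true,
    ⟨.even, wonBy_twoLoops _, wonBy_twoLoops _⟩, ?_⟩
  · obtain ⟨p, hp, hpq⟩ := Strategy.exists_blockSim hG hv hq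
    exact ⟨p, hp, (hpq.mono fun x D h => gsBisimilarBetween_gsQuotient hG h).playEquiv⟩
  · rintro ⟨R, hR, h⟩
    exact absurd (hR.prio_eq _ _ h) (by decide)
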